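/- \textbf{Model.} Fix nodes $\{1,\dots,K\}$ and a set $\mathcal E\subset\{1,\dots,K\}$ of entry nodes. Let $(\mathbf T_m)_{m\ge 1}$, $\mathbf T_m=(T_{k,m})_{k\in\mathcal E}$, be independent random vectors with values in $[0,T]^{\mathcal E}$ (their coordinates may be dependent) such that, for each $k\in\mathcal E$, all $T_{k,m}$ have the same distribution function $F_k$. Put $A_{n,k}(t)=\sum_{m=1}^n \mathbf 1\{T_{k,m}\le t\}$ for $k\in\mathcal E$, and $A_{n,k}=F_k=0$ for $k\notin\mathcal E$. Let $S_{n,k}$ be integer-valued, non-decreasing, right-continuous service processes on $[0,\infty)$ with $S_{n,k}(0)=0$, and let $\mu_{n,k}:[0,\infty)\to[0,\infty)$ be locally integrable. The $i$-th job leaving node $l$ is sent to node $k$ with probability $p_{l,k}$ and otherwise leaves the network; $R_l^k(m)$ is the number of the first $m$ departures from $l$ sent to $k$. The matrix $P=(p_{l,k})$ has spectral radius less than one. Write u.o.c. for uniform convergence on compact subsets of $[0,\infty)$, and assume, for all $k,l$: \begin{itemize} \item (stationary service) there are constants $\mu_k>0$ with $\int_0^t\mu_{n,k}(s)\,ds\to\mu_k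 t$ u.o.c.; \item almost surely $n^{-1}S_{n,k}(t)-\int_0^t\mu_{n,k}(s)\,ds\to0$ u.o.c.; \item almost surely $n^{-1}R_l^k(\lfloor nt\rfloor)\to p_{l,k}t$ u.o.c. \end{itemize} The queue lengths $Q_{n,k}$ are integer-valued right-continuous processes with left limits that satisfy $$Q_{n,k}(t)=A_{n,k}(t)+\sum_{l=1}^K R_l^k\big(S_{n,l}(B_{n,l}(t))\big)-S_{n,k}(B_{n,k}(t)),\qquad B_{n,k}(t)=\int_0^t\mathbf 1\{Q_{n,k}(s)>0\}\,ds .$$ \textbf{Theorem.} Let $\bar X_k(t)=F_k(t)-\mu_k t+\sum_{l=1}^K p_{l,k}\,\mu_l t$. The oblique reflection problem for $\bar{\mathbf X}$ with reflection matrix $V=I-P^{T}$, that is $$z=\bar{\mathbf X}+Vy\ge 0,\qquad y(0)=0,\qquad dy\ge 0,\qquad z_j\,dy_j=0\quad(j=1,\dots,K),$$ has a unique solution $(z,y)$ in the space of right-continuous $\mathbb R^K\times\mathbb R^K$-valued functions on $[0,\infty)$ with left limits. With $\Psi(\bar{\mathbf X})=y$ and $\mathbf M=\mathrm{diag}(1/\mu_1,\dots,1/\mu_K)$,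 the busy-time processes $\bar{\mathbf B}_n=(B_{n,1},\dots,B_{n,K})$ satisfy, almost surely as $n\to\infty$, $$\bar{\mathbf B}_n(t)\;\longrightarrow\; t\,\mathbf 1-\mathbf M\,\Psi(\bar{\mathbf X})(t)\qquad\text{u.o.c. on }[0,\infty).$$ -/

import Mathlib

open MeasureTheory ProbabilityTheory Filter Topology Set

noncomputable section

/-- Uniform convergence on compact subsets of the time axis `[0, ∞)`. -/
def TendstoUOC {β : Type*} [UniformSpace β] (f : ℕ → ℝ → β) (g : ℝ → β) : Prop :=
  ∀ L : ℝ, TendstoUniformlyOn f g atTop (Icc 0 L)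

/-- A path on `[0, ∞)` that is right continuous with left limits. Paths are functions on `ℝ`
of which only the restriction to `[0, ∞)` matters. -/
def IsRCLL {β : Type*} [TopologicalSpace β] (f : ℝ → β) : Prop :=
  (∀ t, 0 ≤ t → ContinuousWithinAt f (Ici t) t) ∧
    ∀ t, 0 < t → ∃ l, Tendsto f (𝓝[<] t) (𝓝 l)

/-! ## The oblique reflection problem -/

/-- `(z, y)` solves the oblique reflection problem for the path `x` with reflection matrix `V`:
`z = x + V y ≥ 0`, `dy ≥ 0`, `y 0 = 0` and `z_j dy_j = 0` for every `j`. The last condition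
says that `z_j` vanishes almost everywhere for the Lebesgue-Stieltjes measure `dy_j` of the
function `y_j`, extended by `y_j 0` to negative times. -/
structure IsObliqueReflection {K : ℕ} (V : Matrix (Fin K) (Fin K) ℝ)
    (x z y : ℝ → Fin K → ℝ) : Prop where
  rcll_z : IsRCLL z
  rcll_y : IsRCLL y
  eq_add : ∀ t, 0 ≤ t → z t = x t + V.mulVec (y t)
  nonneg : ∀ t, 0 ≤ t → ∀ j, 0 ≤ z t j
  mono : ∀ j, MonotoneOn (fun t => y t j) (Ici 0)
  zero : y 0 = 0
  complementary : ∀ j, ∃ g : StieltjesFunction ℝ, (∀ t, g t = y (max t 0) j) ∧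
    ∀ᵐ t ∂g.measure, 0 ≤ t → z t j = 0

open Classical in
/-- The regulator map `Ψ` with reflection matrix `V`: the `y`-component of the solution of the
oblique reflection problem for `x` (with value `0` if there is no solution). -/
def regulator {K : ℕ} (V : Matrix (Fin K) (Fin K) ℝ) (x : ℝ → Fin K → ℝ) : ℝ → Fin K → ℝ :=
  if h : ∃ y, ∃ z, IsObliqueReflection V x z y then h.choose else 0

/-! ## The network -/

/-- The primitives of a sequence of networks with node set `Fin K`. In the `n`-th network each
node of `entry` receives the first `n` exogenous jobs. Jobs and routing decisions are
numbered from `0`. -/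
structure TransitoryNetwork (K : ℕ) (Ω : Type*) where
  /-- nodes with exogenous arrivals -/
  entry : Finset (Fin K)
  /-- all exogenous arrivals take place in `[0, horizon]` -/
  horizon : ℝ
  /-- `epoch m ω e` is the arrival epoch of the `m`-th exogenous job at node `e` -/
  epoch : ℕ → Ω → entry → ℝ
  /-- `service n k ω b` is the number of services completed by the server of node `k` of the
  `n`-th network during its first `b` units of busy time -/
  service : ℕ → Fin K → Ω → ℝ → ℕ
  /-- `route l m ω` is the node to which the `m`-th departure from node `l` is sent; `none`
  means that the job leaves the network -/
  route : Fin K → ℕ → Ω → Option (Fin K)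
  /-- `P l k` is the probability that a job leaving node `l` goes to node `k` -/
  P : Matrix (Fin K) (Fin K) ℝ

namespace TransitoryNetwork

variable {K : ℕ} {Ω : Type*}

/-- The standing model assumptions. -/
structure IsModel [MeasurableSpace Ω] (N : TransitoryNetwork K Ω) (Pr : Measure Ω) : Prop where
  /-- the vectors of arrival epochs are random vectors -/
  measurable_epoch : ∀ m, Measurable (N.epoch m)
  epoch_mem : ∀ m ω e, N.epoch m ω e ∈ Icc 0 N.horizon
  /-- the vectors of arrival epochs of distinct jobs are independent; their coordinates may be
  dependent -/
  indep_epoch : iIndepFun N.epoch Pr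
  /-- the arrival epochs at one node all have the same distribution -/
  ident_epoch : ∀ m e, IdentDistrib (fun ω => N.epoch m ω e) (fun ω => N.epoch 0 ω e) Pr Pr
  measurable_service : ∀ n k b, 0 ≤ b → Measurable fun ω => N.service n k ω b
  service_zero : ∀ n k ω, N.service n k ω 0 = 0
  service_mono : ∀ n k ω, MonotoneOn (N.service n k ω) (Ici 0)
  service_rightCont : ∀ n k ω b, 0 ≤ b → ContinuousWithinAt (N.service n k ω) (Ici b) b
  measurable_route : ∀ l m k, MeasurableSet {ω | N.route l m ω = some k}
  route_prob : ∀ l m k, Pr.real {ω | N.route l m ω = some k} = N.P l k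
  /-- the Harrison-Reiman condition -/
  spectralRadius_lt : spectralRadius ℂ (N.P.map (algebraMap ℝ ℂ)) < 1

/-- `A_{n,k}(t)`: the number of exogenous arrivals at node `k` up to time `t`. -/
def arrivals (N : TransitoryNetwork K Ω) (n : ℕ) (k : Fin K) (ω : Ω) (t : ℝ) : ℕ :=
  if h : k ∈ N.entry then ((Finset.range n).filter fun m => N.epoch m ω ⟨k, h⟩ ≤ t).card else 0

/-- `F_k`: the distribution function of the arrival epochs at node `k`, and `0` at the nodes
without exogenous arrivals. -/
def arrivalCDF [MeasurableSpace Ω] (N : TransitoryNetwork K Ω) (Pr : Measure Ω)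
    (k : Fin K) (t : ℝ) : ℝ :=
  if h : k ∈ N.entry then Pr.real {ω | N.epoch 0 ω ⟨k, h⟩ ≤ t} else 0

/-- `R_l^k(m)`: how many of the first `m` departures from node `l` are sent to node `k`. -/
def routed (N : TransitoryNetwork K Ω) (l k : Fin K) (ω : Ω) (m : ℕ) : ℕ :=
  ((Finset.range m).filter fun i => N.route l i ω = some k).card

/-- The reflection matrix `V = I - Pᵀ`. -/
def reflectionMatrix (N : TransitoryNetwork K Ω) : Matrix (Fin K) (Fin K) ℝ := 1 - N.P.transpose

/-- The fluid netput `X̄_k(t) = F_k(t) - ∫_0^t μ_k(s) ds + ∑_l p_{l,k} ∫_0^t μ_l(s) ds`. -/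
def fluidNetput [MeasurableSpace Ω] (N : TransitoryNetwork K Ω) (Pr : Measure Ω)
    (μ : Fin K → ℝ → ℝ) (t : ℝ) (k : Fin K) : ℝ :=
  N.arrivalCDF Pr k t - (∫ s in (0 : ℝ)..t, μ k s) + ∑ l, N.P l k * ∫ s in (0 : ℝ)..t, μ l s

end TransitoryNetwork

/-- The busy time `B(t) = ∫_0^t 1_{q(s) > 0} ds` of a server with queue-length path `q`. -/
def busyTime (q : ℝ → ℤ) (t : ℝ) : ℝ := ∫ s in (0 : ℝ)..t, if 0 < q s then 1 else 0

/-- `q` is a queue-length path of the `n`-th network at the sample point `ω`: it is right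
continuous with left limits and solves
`q_k(t) = A_{n,k}(t) + ∑_l R_l^k(S_{n,l}(B_l(t))) - S_{n,k}(B_k(t))`,
where `B_k` is the busy time belonging to `q_k`. -/
structure TransitoryNetwork.IsQueuePath {K : ℕ} {Ω : Type*} (N : TransitoryNetwork K Ω)
    (n : ℕ) (ω : Ω) (q : Fin K → ℝ → ℤ) : Prop where
  rcll : ∀ k, IsRCLL (q k)
  balance : ∀ t, 0 ≤ t → ∀ k,
    q k t = (N.arrivals n k ω t : ℤ)
      + ∑ l, (N.routed l k ω (N.service n l ω (busyTime (q l) t)) : ℤ)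
      - (N.service n k ω (busyTime (q k) t) : ℤ)

end

/-! For `V = I - Pᵀ`, the regulator is the fixed point of `y ↦ sup_{s ≤ t} (Pᵀ y(s) - x(s))⁺`. Since
`P ≥ 0` has spectral radius below one, there is a weight `u ≥ 1` with `Pᵀ u ≤ u - 1`
(`exists_one_le_superharmonic`), and in the sup norm weighted by `u` this map is a contraction. The
argument tolerates errors: two `ε`-approximate fixed points whose inputs differ by at most `δ`
differ at node `k` by at most `(2ε + δ) u_k` (`IsApproxRegulator.abs_sub_le`). Exact solutions are
`ε`-approximate for every `ε > 0`, which gives uniqueness.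

In the `n`-th network the scaled idle times `μ_k (t - B_k(t))` are approximate fixed points for the
scaled netput. By the laws of large numbers for services and routing, the queue divided by `n` is
nearly netput plus `V` times idle time; it is nearly nonnegative, and idle time accrues only while
the queue is not positive. The scaled netput converges by Glivenko-Cantelli, so stability makes the
idle times uniformly Cauchy on compacts. Their limit solves the reflection problem
(`exists_isObliqueReflection_of_approx`), which proves existence and convergence together; solving
`idle = μ_k (t - B_k)` for `B_k` gives the busy times. -/

/-! ### Powers of the routing matrix and a superharmonic weight. -/

section Substochastic

attribute [local instance] Matrix.linftyOpNormedRing Matrix.linftyOpNormedAlgebra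

/-- Gelfand's formula: for any `c` between the spectral radius and 1, eventually `‖a ^ n‖ ≤ c ^ n`.
-/
theorem tendsto_pow_of_spectralRadius_lt_one {A : Type*} [NormedRing A] [NormedAlgebra ℂ A]
    [CompleteSpace A] {a : A} (h : spectralRadius ℂ a < 1) :
    Tendsto (fun n => a ^ n) atTop (𝓝 0) := by
  obtain ⟨c, hc, hc1⟩ := ENNReal.lt_iff_exists_nnreal_btwn.1 h
  have hlim := spectrum.pow_nnnorm_pow_one_div_tendsto_nhds_spectralRadius a
  have hc1' : c < 1 := by exact_mod_cast hc1
  have hle : ∀ᶠ n : ℕ in atTop, ‖a ^ n‖ ≤ (c : ℝ) ^ n := by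
    filter_upwards [hlim.eventually_lt_const hc, eventually_gt_atTop 0] with n hn hn0
    have hn0' : (0 : ℝ) < n := by exact_mod_cast hn0
    have h1 := (ENNReal.rpow_lt_rpow_iff hn0').2 hn
    rw [← ENNReal.rpow_mul, one_div, inv_mul_cancel₀ hn0'.ne', ENNReal.rpow_one,
      ENNReal.rpow_natCast] at h1
    exact_mod_cast h1.le
  exact squeeze_zero_norm' hle (tendsto_pow_atTop_nhds_zero_of_lt_one c.2 (by exact_mod_cast hc1'))

theorem tendsto_pow_entry_of_spectralRadius_lt_one {K : ℕ} {P : Matrix (Fin K) (Fin K) ℝ}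
    (h : spectralRadius ℂ (P.map (algebraMap ℝ ℂ)) < 1) (i j : Fin K) :
    Tendsto (fun n => (P ^ n) i j) atTop (𝓝 0) := by
  have h1 := tendsto_pow_of_spectralRadius_lt_one h
  have h2 : Tendsto (fun n => ((P.map (algebraMap ℝ ℂ)) ^ n) i j) atTop (𝓝 0) :=
    ((continuous_apply_apply i j).tendsto _).comp h1
  have h3 : ∀ n, ((P.map (algebraMap ℝ ℂ)) ^ n) i j = (((P ^ n) i j : ℝ) : ℂ) := by
    intro n
    have := map_pow (algebraMap ℝ ℂ).mapMatrix P n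
    simp only [RingHom.mapMatrix_apply] at this
    rw [← this]; simp
  simp only [h3] at h2
  have h4 := (Complex.continuous_re.tendsto _).comp h2
  rw [Complex.zero_re] at h4
  exact h4

end Substochastic

/-- A truncated Neumann series `2 ∑_{n < N} (Pᵀ)ⁿ 1` works: applying `Pᵀ` shifts the index, so only
the two end terms change. -/
theorem exists_one_le_superharmonic {K : ℕ} {P : Matrix (Fin K) (Fin K) ℝ}
    (hP : ∀ i j, 0 ≤ P i j) (h : spectralRadius ℂ (P.map (algebraMap ℝ ℂ)) < 1) :
    ∃ u : Fin K → ℝ, (∀ k, 1 ≤ u k) ∧ ∀ k, ∑ l, P l k * u l ≤ u k - 1 := by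
  have hlim : ∀ k, Tendsto (fun n => ∑ l, (P ^ n) l k) atTop (𝓝 0) := fun k => by
    simpa using tendsto_finsetSum Finset.univ
      fun l _ => tendsto_pow_entry_of_spectralRadius_lt_one h l k
  have hev : ∀ᶠ n in atTop, ∀ k, ∑ l, (P ^ n) l k < 1 / 2 :=
    eventually_all.2 fun k => (hlim k).eventually_lt_const (by norm_num)
  obtain ⟨N, hN, hN1⟩ := (hev.and (eventually_ge_atTop 1)).exists
  have hpow : ∀ n i j, 0 ≤ (P ^ n) i j := by
    intro n
    induction n with
    | zero => intro i j; rw [pow_zero, Matrix.one_apply]; split_ifs <;> norm_num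
    | succ n ih =>
      intro i j
      rw [pow_succ, Matrix.mul_apply]
      exact Finset.sum_nonneg fun l _ => mul_nonneg (ih i l) (hP l j)
  have hstep : ∀ n k, ∑ l, P l k * ∑ i, (P ^ n) i l = ∑ i, (P ^ (n + 1)) i k := by
    intro n k
    simp_rw [pow_succ, Matrix.mul_apply, Finset.mul_sum]
    rw [Finset.sum_comm]
    simp_rw [mul_comm]
  have hone : ∀ k, ∑ l, (P ^ 0) l k = 1 := fun k => by simp [Matrix.one_apply]
  -- The factor 2 absorbs the leftover `∑ i, (P ^ N) i k < 1 / 2`: the change is at most `-2 + 2 ·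
  -- (1 / 2) = -1`.
  refine ⟨fun k => 2 * ∑ n ∈ Finset.range N, ∑ i, (P ^ n) i k, fun k => ?_, fun k => ?_⟩
  · have := Finset.single_le_sum (f := fun n => ∑ i, (P ^ n) i k)
      (fun n _ => Finset.sum_nonneg fun i _ => hpow n i k) (Finset.mem_range.2 hN1)
    simp only [hone] at this
    linarith
  · have h1 : ∑ l, P l k * (2 * ∑ n ∈ Finset.range N, ∑ i, (P ^ n) i l)
        = 2 * ∑ n ∈ Finset.range N, ∑ i, (P ^ (n + 1)) i k := by
      simp_rw [← hstep, Finset.mul_sum (Finset.range N)]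
      rw [Finset.sum_comm]
      refine Finset.sum_congr rfl fun n _ => ?_
      rw [Finset.mul_sum]
      exact Finset.sum_congr rfl fun l _ => by ring
    have h2 := Finset.sum_range_succ' (fun n => ∑ i, (P ^ n) i k) N
    rw [Finset.sum_range_succ, hone] at h2
    have h3 := hN k
    rw [h1]
    linarith

/-- On `[0, L]`, the path `y` is up to an error `ε` the fixed point of the map
`y ↦ (sup_{s ≤ t} (Pᵀ y(s) - x(s))⁺)_t`. -/
def IsApproxRegulator {K : ℕ} (P : Matrix (Fin K) (Fin K) ℝ) (ε L : ℝ) (x y : ℝ → Fin K → ℝ) :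
    Prop :=
  ∀ k, ∀ t ∈ Icc 0 L, 0 ≤ y t k ∧
    (∀ s ∈ Icc 0 t, ∑ l, P l k * y s l - x s k ≤ y t k + ε) ∧
    (y t k ≤ ε ∨ ∃ s ∈ Icc 0 t, y t k ≤ ∑ l, P l k * y s l - x s k + ε)

/-! ### Stability of approximate regulators. -/

namespace IsApproxRegulator

variable {K : ℕ} {P : Matrix (Fin K) (Fin K) ℝ}

/-- The time `s` that nearly attains the supremum for `y` is also admissible in the supremum for
`y'`. Each of the two comparisons costs one `ε`. -/
theorem sub_le {ε δ L : ℝ} {x y x' y' : ℝ → Fin K → ℝ} {d : Fin K → ℝ}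
    (h : IsApproxRegulator P ε L x y) (h' : IsApproxRegulator P ε L x' y')
    (hP : ∀ i j, 0 ≤ P i j) (hε : 0 ≤ ε)
    (hx : ∀ t ∈ Icc 0 L, ∀ k, |x t k - x' t k| ≤ δ)
    (hd : ∀ t ∈ Icc 0 L, ∀ k, |y t k - y' t k| ≤ d k) {t : ℝ} (ht : t ∈ Icc 0 L) (k : Fin K) :
    y t k - y' t k ≤ 2 * ε + δ + ∑ l, P l k * d l := by
  have hδ : 0 ≤ δ := (abs_nonneg _).trans (hx t ht k)
  have hsum : 0 ≤ ∑ l, P l k * d l :=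
    Finset.sum_nonneg fun l _ => mul_nonneg (hP l k) ((abs_nonneg _).trans (hd t ht l))
  obtain ⟨h0, h1, -⟩ := h' k t ht
  rcases (h k t ht).2.2 with h2 | ⟨s, hs, h2⟩
  · linarith
  · have hsL : s ∈ Icc 0 L := ⟨hs.1, hs.2.trans ht.2⟩
    have h3 := h1 s hs
    have h4 := (abs_le.1 (hx s hsL k)).1
    have h5 : ∑ l, P l k * y s l ≤ ∑ l, P l k * y' s l + ∑ l, P l k * d l := by
      rw [← Finset.sum_add_distrib]
      refine Finset.sum_le_sum fun l _ => ?_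
      rw [← mul_add]
      exact mul_le_mul_of_nonneg_left (by linarith [(abs_le.1 (hd s hsL l)).2]) (hP l k)
    linarith

/-- Iterating `sub_le` contracts the weighted distance. The crude bound `D` only starts the
iteration; its contribution `r ^ m * D` vanishes as `m → ∞`. -/
theorem abs_sub_le {ε δ L D : ℝ} {x y x' y' : ℝ → Fin K → ℝ} {u : Fin K → ℝ}
    (h : IsApproxRegulator P ε L x y) (h' : IsApproxRegulator P ε L x' y')
    (hP : ∀ i j, 0 ≤ P i j) (hu1 : ∀ k, 1 ≤ u k) (hu : ∀ k, ∑ l, P l k * u l ≤ u k - 1)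
    (hε : 0 ≤ ε)
    (hx : ∀ t ∈ Icc 0 L, ∀ k, |x t k - x' t k| ≤ δ)
    (hD : ∀ t ∈ Icc 0 L, ∀ k, |y t k - y' t k| ≤ D) {t : ℝ} (ht : t ∈ Icc 0 L) (k : Fin K) :
    |y t k - y' t k| ≤ (2 * ε + δ) * u k := by
  have hδ : 0 ≤ δ := (abs_nonneg _).trans (hx t ht k)
  have hD0 : 0 ≤ D := (abs_nonneg _).trans (hD t ht k)
  obtain ⟨M, hM⟩ : ∃ M, ∀ k, u k ≤ M :=
    ⟨∑ k, u k, fun k => Finset.single_le_sum (fun i _ => zero_le_one.trans (hu1 i))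
      (Finset.mem_univ k)⟩
  have hM1 : 1 ≤ M := (hu1 k).trans (hM k)
  -- The contraction factor: `Pᵀ u ≤ u - 1 ≤ (1 - 1 / M) u` because `u ≤ M`.
  set r := 1 - 1 / M with hr
  have hr0 : 0 ≤ r := by
    rw [hr, sub_nonneg, div_le_one (by linarith)]; exact hM1
  have hr1 : r < 1 := by
    have : 0 < 1 / M := by positivity
    linarith
  have hx' : ∀ t ∈ Icc 0 L, ∀ k, |x' t k - x t k| ≤ δ := fun t ht k => by
    rw [abs_sub_comm]; exact hx t ht k
  have key : ∀ m : ℕ, ∀ t ∈ Icc 0 L, ∀ k,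
      |y t k - y' t k| ≤ (2 * ε + δ + r ^ m * D) * u k := by
    intro m
    induction m with
    | zero =>
      intro t ht k
      have := hD t ht k
      have h1 := hu1 k
      rw [pow_zero, one_mul]
      nlinarith
    | succ m ih =>
      intro t ht k
      have hsym : ∀ t ∈ Icc 0 L, ∀ k, |y' t k - y t k| ≤ (2 * ε + δ + r ^ m * D) * u k :=
        fun t ht k => by rw [abs_sub_comm]; exact ih t ht k
      have h1 := sub_le h h' hP hε hx ih ht k
      have h2 := sub_le h' h hP hε hx' hsym ht k
      have hE : 0 ≤ r ^ m * D := by positivity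
      have h3 : ∑ l, P l k * ((2 * ε + δ + r ^ m * D) * u l)
          ≤ (2 * ε + δ + r ^ m * D) * (u k - 1) := by
        have := mul_le_mul_of_nonneg_left (hu k) (by linarith : 0 ≤ 2 * ε + δ + r ^ m * D)
        rw [Finset.mul_sum] at this
        refine le_trans (le_of_eq (Finset.sum_congr rfl fun l _ => by ring)) this
      have h4 : r ^ m * D * (u k / M) ≤ r ^ m * D * 1 :=
        mul_le_mul_of_nonneg_left ((div_le_one (by linarith)).2 (hM k)) hE
      have h5 : r ^ (m + 1) * D * u k = r ^ m * D * u k - r ^ m * D * (u k / M) := by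
        rw [pow_succ, hr]; ring
      rw [abs_le]
      constructor <;> nlinarith
  have hlim : Tendsto (fun m : ℕ => (2 * ε + δ + r ^ m * D) * u k) atTop
      (𝓝 ((2 * ε + δ + 0 * D) * u k)) :=
    (((tendsto_pow_atTop_nhds_zero_of_lt_one hr0 hr1).mul_const D).const_add _).mul_const _
  have := ge_of_tendsto' hlim fun m => key m t ht k
  simpa using this

end IsApproxRegulator

/-! ### Uniqueness for the oblique reflection problem. -/

theorem mulVec_one_sub_transpose {K : ℕ} (P : Matrix (Fin K) (Fin K) ℝ) (v : Fin K → ℝ)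
    (k : Fin K) : (1 - P.transpose).mulVec v k = v k - ∑ l, P l k * v l := by
  rw [Matrix.sub_mulVec, Matrix.one_mulVec]
  simp [Matrix.mulVec, dotProduct, Matrix.transpose_apply]

/-- If almost every point of growth of a right-continuous distribution function lies in `Z`, its
values at points of `Z` come arbitrarily close to any value above the initial one. -/
theorem StieltjesFunction.exists_mem_lt (g : StieltjesFunction ℝ) {Z : Set ℝ}
    (hZ : ∀ᵐ t ∂g.measure, 0 ≤ t → t ∈ Z) {t c : ℝ} (h0 : g 0 ≤ c) (hc : c < g t) :
    ∃ s ∈ Ioc 0 t, s ∈ Z ∧ c < g s := by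
  by_contra! hcon
  have ht0 : 0 < t := by
    by_contra! h
    exact absurd (g.mono h) (by linarith)
  set W := {s ∈ Ioc 0 t | s ∈ Z} with hW
  have hnull : ∀ A ⊆ Ioc 0 t, Disjoint A W → g.measure A = 0 := by
    intro A hA hdisj
    refine measure_mono_null (fun s hs => ?_) hZ
    refine Classical.not_imp.2 ?_
    exact ⟨(hA hs).1.le, fun hsZ => hdisj.le_bot ⟨hs, hA hs, hsZ⟩⟩
  rcases W.eq_empty_or_nonempty with hWe | hWne
  · have := hnull (Ioc 0 t) subset_rfl (by rw [hWe]; exact disjoint_bot_right)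
    rw [g.measure_Ioc, ENNReal.ofReal_eq_zero] at this
    linarith
  have hbdd : BddAbove W := ⟨t, fun s hs => hs.1.2⟩
  -- No mass lies in `(σ, t]`. If `σ ∈ W`, then `g t = g σ ≤ c`. Otherwise `σ` carries no atom
  -- either, so `g t` is the left limit at `σ`, which is at most `c` because points of `W`
  -- accumulate at `σ` from the left.
  set σ := sSup W with hσ
  have hσt : σ ≤ t := csSup_le hWne fun s hs => hs.1.2
  have hσ0 : 0 < σ := by
    obtain ⟨s, hs⟩ := hWne
    exact hs.1.1.trans_le (le_csSup hbdd hs)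
  have hσt' : Disjoint (Ioc σ t) W := Set.disjoint_left.2 fun s hs hsW =>
    absurd (le_csSup hbdd hsW) (not_le.2 hs.1)
  by_cases hσW : σ ∈ W
  · have := hnull (Ioc σ t) (Ioc_subset_Ioc_left hσ0.le) hσt'
    rw [g.measure_Ioc, ENNReal.ofReal_eq_zero] at this
    linarith [hcon σ hσW.1 hσW.2]
  · have := hnull (Icc σ t) (fun s hs => ⟨hσ0.trans_le hs.1, hs.2⟩)
      (Set.disjoint_left.2 fun s hs hsW => by
        rcases hs.1.eq_or_lt with h | h
        · exact hσW (h ▸ hsW)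
        · exact Set.disjoint_left.1 hσt' ⟨h, hs.2⟩ hsW)
    rw [g.measure_Icc, ENNReal.ofReal_eq_zero] at this
    have hlim : Function.leftLim g σ ≤ c := by
      refine le_of_tendsto (g.mono.tendsto_leftLim σ) ?_
      filter_upwards [self_mem_nhdsWithin] with s hs
      obtain ⟨w, hw, hsw⟩ := exists_lt_of_lt_csSup hWne (show s < sSup W from hs)
      exact (g.mono hsw.le).trans (hcon w hw.1 hw.2)
    linarith

/-- By complementarity `y_k` grows only on zeros of `z_k`, where `y_k = ∑ l, P l k * y_l - x_k`. The
level `y t k` may only be approached along such zeros, hence the slack `ε`; the alternative `y t k ≤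
ε` covers levels too low to be searched for. -/
theorem IsObliqueReflection.isApproxRegulator {K : ℕ} {P : Matrix (Fin K) (Fin K) ℝ}
    {x z y : ℝ → Fin K → ℝ} (h : IsObliqueReflection (1 - P.transpose) x z y) {ε : ℝ}
    (hε : 0 < ε) (L : ℝ) : IsApproxRegulator P ε L x y := by
  have hz : ∀ t, 0 ≤ t → ∀ k, z t k = x t k + (y t k - ∑ l, P l k * y t l) := fun t ht k => by
    rw [h.eq_add t ht, Pi.add_apply, mulVec_one_sub_transpose]
  intro k t ht
  refine ⟨?_, fun s hs => ?_, ?_⟩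
  · have := h.mono k (self_mem_Ici) ht.1 ht.1
    simpa [h.zero] using this
  · have h1 := h.mono k hs.1 ht.1 hs.2
    have h2 := h.nonneg s hs.1 k
    rw [hz s hs.1] at h2
    linarith
  · rw [or_iff_not_imp_left, not_le]
    intro hlt
    obtain ⟨g, hg, hae⟩ := h.complementary k
    have hg0 : g 0 = 0 := by simp [hg, h.zero]
    have hgt : ∀ s, 0 ≤ s → g s = y s k := fun s hs => by rw [hg, max_eq_left hs]
    obtain ⟨s, hs, hsZ, hlt'⟩ := g.exists_mem_lt (Z := {s | z s k = 0}) hae (t := t)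
      (c := y t k - ε) (by rw [hg0]; linarith) (by rw [hgt t ht.1]; linarith)
    rw [hgt s hs.1.le] at hlt'
    have h2 : z s k = 0 := hsZ
    rw [hz s hs.1.le] at h2
    exact ⟨s, ⟨hs.1.le, hs.2⟩, by linarith⟩

/-- The regulator of the oblique reflection problem is unique. -/
theorem IsObliqueReflection.eqOn {K : ℕ} {P : Matrix (Fin K) (Fin K) ℝ} (hP : ∀ i j, 0 ≤ P i j)
    (hspec : spectralRadius ℂ (P.map (algebraMap ℝ ℂ)) < 1) {x z y z' y' : ℝ → Fin K → ℝ}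
    (h : IsObliqueReflection (1 - P.transpose) x z y)
    (h' : IsObliqueReflection (1 - P.transpose) x z' y') : EqOn y y' (Ici 0) := by
  obtain ⟨u, hu1, hu⟩ := exists_one_le_superharmonic hP hspec
  intro t ht
  ext k
  have hbound : ∀ s ∈ Icc 0 t, ∀ k, |y s k - y' s k| ≤ ∑ j, (y t j + y' t j) := by
    intro s hs j
    have h1 := fun j => h.mono j self_mem_Ici hs.1 hs.1
    have h2 := fun j => h.mono j hs.1 ht hs.2
    have h3 := fun j => h'.mono j self_mem_Ici hs.1 hs.1
    have h4 := fun j => h'.mono j hs.1 ht hs.2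
    simp only [h.zero, h'.zero, Pi.zero_apply] at h1 h2 h3 h4
    have h5 := Finset.single_le_sum (f := fun j => y t j + y' t j)
      (fun j _ => by linarith [h1 j, h2 j, h3 j, h4 j]) (Finset.mem_univ j)
    rw [abs_le]
    constructor <;> linarith [h1 j, h2 j, h3 j, h4 j]
  have key : ∀ ε : ℝ, 0 < ε → |y t k - y' t k| ≤ (2 * ε + 0) * u k := fun ε hε =>
    (h.isApproxRegulator hε t).abs_sub_le (h'.isApproxRegulator hε t) hP hu1 hu hε.le
      (fun s _ j => by simp) hbound ⟨ht, le_rfl⟩ k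
  have huk : 0 < u k := zero_lt_one.trans_le (hu1 k)
  have : |y t k - y' t k| ≤ 0 := le_of_forall_pos_le_add fun ε hε => by
    have := key (ε / (2 * u k)) (by positivity)
    field_simp at this
    linarith
  linarith [abs_nonpos_iff.1 this]

/-! ### Existence, as a limit of approximate regulators. -/

/-- One-sided intervals are not neighbourhoods, so `S` is first cut into countably many pieces
sharing a rational right end `q`. Inside a piece, `Ico s q` from an earlier point `s` is a null
neighbourhood of `t`; if there is none, `t` is the minimum and `Ico t q` contains the whole piece.
-/
theorem measure_eq_zero_of_forall_Ico {ν : Measure ℝ} {S : Set ℝ}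
    (h : ∀ t ∈ S, ∃ b, t < b ∧ ν (Ico t b) = 0) : ν S = 0 := by
  have hsub : S ⊆ ⋃ q : ℚ, {t ∈ S | t < q ∧ ν (Ico t q) = 0} := by
    intro t ht
    obtain ⟨b, hb, hnull⟩ := h t ht
    obtain ⟨q, hq, hqb⟩ := exists_rat_btwn hb
    exact mem_iUnion.2 ⟨q, ht, hq, measure_mono_null (Ico_subset_Ico_right hqb.le) hnull⟩
  refine measure_mono_null hsub (measure_iUnion_null fun q => ?_)
  refine measure_null_of_locally_null _ fun t ht => ?_
  by_cases hex : ∃ s ∈ {t ∈ S | t < q ∧ ν (Ico t q) = 0}, s < t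
  · obtain ⟨s, hs, hst⟩ := hex
    exact ⟨Ico s q, mem_nhdsWithin_of_mem_nhds (Ico_mem_nhds hst ht.2.1), hs.2.2⟩
  · push Not at hex
    exact ⟨Ico t q, mem_of_superset self_mem_nhdsWithin fun s hs => ⟨hex s hs, hs.2.1⟩, ht.2.2⟩

theorem ContinuousOn.isRCLL {β : Type*} [TopologicalSpace β] {f : ℝ → β}
    (hf : ContinuousOn f (Ici 0)) : IsRCLL f :=
  ⟨fun t ht => (hf t ht).mono (Ici_subset_Ici.2 ht), fun t ht =>
    ⟨f t, (hf.continuousAt (Ici_mem_nhds ht)).tendsto.mono_left nhdsWithin_le_nhds⟩⟩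

theorem IsRCLL.add {β : Type*} [TopologicalSpace β] [Add β] [ContinuousAdd β] {f g : ℝ → β}
    (hf : IsRCLL f) (hg : IsRCLL g) : IsRCLL fun t => f t + g t := by
  refine ⟨fun t ht => (hf.1 t ht).add (hg.1 t ht), fun t ht => ?_⟩
  obtain ⟨a, ha⟩ := hf.2 t ht
  obtain ⟨b, hb⟩ := hg.2 t ht
  exact ⟨a + b, ha.add hb⟩

theorem isRCLL_pi {ι β : Type*} [TopologicalSpace β] {f : ℝ → ι → β}
    (hf : ∀ i, IsRCLL fun t => f t i) : IsRCLL f := by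
  refine ⟨fun t ht => continuousWithinAt_pi.2 fun i => (hf i).1 t ht, fun t ht => ?_⟩
  choose l hl using fun i => (hf i).2 t ht
  exact ⟨l, tendsto_pi_nhds.2 hl⟩

theorem TendstoUOC.tendsto {β : Type*} [UniformSpace β] {f : ℕ → ℝ → β} {g : ℝ → β}
    (h : TendstoUOC f g) {t : ℝ} (ht : 0 ≤ t) : Tendsto (fun n => f n t) atTop (𝓝 (g t)) :=
  (h t).tendsto_at ⟨ht, le_rfl⟩

theorem TendstoUOC.eventually_abs_sub_le {f : ℕ → ℝ → ℝ} {g : ℝ → ℝ} (h : TendstoUOC f g)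
    (L : ℝ) {ε : ℝ} (hε : 0 < ε) : ∀ᶠ n in atTop, ∀ t ∈ Icc 0 L, |f n t - g t| ≤ ε := by
  filter_upwards [Metric.tendstoUniformlyOn_iff.1 (h L) ε hε] with n hn t ht
  have := hn t ht
  rw [dist_comm, Real.dist_eq] at this
  exact this.le

theorem tendstoUOC_of_eventually {f : ℕ → ℝ → ℝ} {g : ℝ → ℝ}
    (h : ∀ L, ∀ ε > 0, ∀ᶠ n in atTop, ∀ t ∈ Icc 0 L, |f n t - g t| ≤ ε) : TendstoUOC f g := by
  refine fun L => Metric.tendstoUniformlyOn_iff.2 fun ε hε => ?_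
  filter_upwards [h L (ε / 2) (half_pos hε)] with n hn t ht
  rw [dist_comm, Real.dist_eq]
  exact (hn t ht).trans_lt (half_lt_self hε)

/-- Paths that regulate converging inputs up to vanishing errors, and grow only while the regulated
path is small, converge to the solution of the oblique reflection problem. -/
theorem exists_isObliqueReflection_of_approx {K : ℕ} {P : Matrix (Fin K) (Fin K) ℝ}
    (hP : ∀ i j, 0 ≤ P i j) (hspec : spectralRadius ℂ (P.map (algebraMap ℝ ℂ)) < 1)
    {x : ℝ → Fin K → ℝ} {xn yn : ℕ → ℝ → Fin K → ℝ} {c : Fin K → ℝ} (hx : IsRCLL x)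
    (hxn : ∀ k, TendstoUOC (fun n t => xn n t k) fun t => x t k)
    (happrox : ∀ L, ∀ ε > 0, ∀ᶠ n in atTop, IsApproxRegulator P ε L (xn n) (yn n))
    (hzero : ∀ n k, yn n 0 k = 0)
    (hmono : ∀ n k s t, 0 ≤ s → s ≤ t → yn n s k ≤ yn n t k)
    (hlip : ∀ n k s t, 0 ≤ s → s ≤ t → yn n t k - yn n s k ≤ c k * (t - s))
    (hflat : ∀ L, ∀ η > 0, ∀ᶠ n in atTop, ∀ k s t, 0 ≤ s → s ≤ t → t ≤ L →
      (∀ r ∈ Icc s t, η < xn n r k + (yn n r k - ∑ l, P l k * yn n r l)) →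
      yn n t k = yn n s k) :
    ∃ y, IsObliqueReflection (1 - P.transpose) x
        (fun t => x t + (1 - P.transpose).mulVec (y t)) y ∧
      ∀ k, TendstoUOC (fun n t => yn n t k) fun t => y t k := by
  obtain ⟨u, hu1, hu⟩ := exists_one_le_superharmonic hP hspec
  have hcauchy : ∀ k L, UniformCauchySeqOn (fun n t => yn n t k) atTop (Icc 0 L) := by
    intro k L
    refine Metric.uniformCauchySeqOn_iff.2 fun ε hε => ?_
    have huk : 0 < u k := zero_lt_one.trans_le (hu1 k)
    -- Stability will give `(2θ + 2θ) u_k = ε / 2`: `2θ` for the approximation and `2θ` for two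
    -- inputs, each within `θ` of `x`.
    set θ := ε / (8 * u k) with hθ
    have hθ0 : 0 < θ := by positivity
    have h1 : ∀ᶠ n in atTop, ∀ j, ∀ t ∈ Icc 0 L, |xn n t j - x t j| ≤ θ :=
      eventually_all.2 fun j => (hxn j).eventually_abs_sub_le L hθ0
    obtain ⟨N, hN⟩ := eventually_atTop.1 (h1.and (happrox L θ hθ0))
    refine ⟨N, fun m hm n hn t ht => ?_⟩
    have h2 : ∀ s ∈ Icc 0 L, ∀ j, |xn m s j - xn n s j| ≤ 2 * θ := fun s hs j => by
      have ha := abs_le.1 ((hN m hm).1 j s hs)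
      have hb := abs_le.1 ((hN n hn).1 j s hs)
      rw [abs_le]
      constructor <;> linarith [ha.1, ha.2, hb.1, hb.2]
    have hrange : ∀ n j, ∀ s ∈ Icc 0 L, 0 ≤ yn n s j ∧ yn n s j ≤ yn n L j ∧
        yn n L j ≤ c j * L := by
      intro n j s hs
      have ha := hmono n j 0 s le_rfl hs.1
      have hb := hmono n j s L hs.1 hs.2
      have hc := hlip n j 0 L le_rfl (hs.1.trans hs.2)
      rw [hzero] at ha hc
      rw [sub_zero, sub_zero] at hc
      exact ⟨ha, hb, hc⟩
    have h3 : ∀ s ∈ Icc 0 L, ∀ j, |yn m s j - yn n s j| ≤ ∑ i, c i * L := by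
      intro s hs j
      have ha := Finset.single_le_sum (f := fun i => c i * L)
        (fun i _ => by linarith [hrange m i s hs]) (Finset.mem_univ j)
      rw [abs_le]
      constructor <;> linarith [hrange m j s hs, hrange n j s hs]
    have h4 := (hN m hm).2.abs_sub_le (hN n hn).2 hP hu1 hu hθ0.le h2 h3 ht k
    rw [Real.dist_eq]
    refine h4.trans_lt ?_
    have : (2 * θ + 2 * θ) * u k = ε / 2 := by
      rw [hθ]; field_simp; norm_num
    rw [this]
    exact half_lt_self hε
  have hex : ∀ t k, ∃ v, 0 ≤ t → Tendsto (fun n => yn n t k) atTop (𝓝 v) := by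
    intro t k
    by_cases ht : 0 ≤ t
    · obtain ⟨v, hv⟩ := cauchySeq_tendsto_of_complete
        ((hcauchy k t).cauchySeq (x := t) ⟨ht, le_rfl⟩)
      exact ⟨v, fun _ => hv⟩
    · exact ⟨0, fun h => absurd h ht⟩
  choose y hy using hex
  have huoc : ∀ k, TendstoUOC (fun n t => yn n t k) fun t => y t k := fun k L =>
    (hcauchy k L).tendstoUniformlyOn_of_tendsto fun t ht => hy t k ht.1
  have hy0 : ∀ k, y 0 k = 0 := fun k => by
    refine tendsto_nhds_unique (hy 0 k le_rfl) ?_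
    simp only [hzero]
    exact tendsto_const_nhds
  have hymono : ∀ k s t, 0 ≤ s → s ≤ t → y s k ≤ y t k := fun k s t hs hst =>
    le_of_tendsto_of_tendsto' (hy s k hs) (hy t k (hs.trans hst)) fun n => hmono n k s t hs hst
  have hylip : ∀ k s t, 0 ≤ s → s ≤ t → y t k - y s k ≤ c k * (t - s) := fun k s t hs hst =>
    le_of_tendsto' ((hy t k (hs.trans hst)).sub (hy s k hs)) fun n => hlip n k s t hs hst
  have hycont : ∀ k, ContinuousOn (fun t => y t k) (Ici 0) := by
    intro k
    have hlipk : LipschitzOnWith (Real.toNNReal (c k)) (fun t => y t k) (Ici 0) := by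
      have aux : ∀ s t, 0 ≤ s → s ≤ t → |y t k - y s k| ≤ (Real.toNNReal (c k) : ℝ) * |t - s| := by
        intro s t hs hst
        rw [abs_of_nonneg (sub_nonneg.2 (hymono k s t hs hst)), abs_of_nonneg (sub_nonneg.2 hst)]
        exact (hylip k s t hs hst).trans
          (mul_le_mul_of_nonneg_right (Real.le_coe_toNNReal _) (sub_nonneg.2 hst))
      refine LipschitzOnWith.of_dist_le_mul fun t ht s hs => ?_
      rw [Real.dist_eq, Real.dist_eq]
      rcases le_total s t with h | h
      · exact aux s t hs h
      · rw [abs_sub_comm, abs_sub_comm t s]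
        exact aux t s ht h
    exact hlipk.continuousOn
  have hycont' : ContinuousOn y (Ici 0) := continuousOn_pi.2 hycont
  have hVcont : ContinuousOn (fun t => (1 - P.transpose).mulVec (y t)) (Ici 0) :=
    (Continuous.matrix_mulVec continuous_const continuous_id).comp_continuousOn hycont'
  have hz : ∀ t k, (x t + (1 - P.transpose).mulVec (y t)) k
      = x t k + (y t k - ∑ l, P l k * y t l) := fun t k => by
    rw [Pi.add_apply, mulVec_one_sub_transpose]
  have hztend : ∀ t k, 0 ≤ t → Tendsto
      (fun n => xn n t k + (yn n t k - ∑ l, P l k * yn n t l)) atTop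
      (𝓝 (x t k + (y t k - ∑ l, P l k * y t l))) := fun t k ht =>
    ((hxn k).tendsto ht).add ((hy t k ht).sub
      (tendsto_finsetSum _ fun l _ => (hy t l ht).const_mul _))
  refine ⟨y, ⟨hx.add hVcont.isRCLL, hycont'.isRCLL, fun t _ => rfl, fun t ht k => ?_,
    fun k s hs t ht hst => hymono k s t hs hst, funext hy0, fun k => ?_⟩, huoc⟩
  · rw [hz]
    refine le_of_forall_pos_le_add fun ε hε => ge_of_tendsto ((hztend t k ht).add_const ε) ?_
    filter_upwards [happrox t ε hε] with n hn
    have := (hn k t ⟨ht, le_rfl⟩).2.1 t ⟨ht, le_rfl⟩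
    linarith
  · have hgcont : Continuous fun t => y (max t 0) k :=
      (hycont k).comp_continuous (continuous_id.max continuous_const) fun t =>
        mem_Ici.2 (le_max_right _ _)
    let g : StieltjesFunction ℝ :=
      { toFun := fun t => y (max t 0) k
        mono' := fun s t hst => hymono k _ _ (le_max_right _ _) (max_le_max_right 0 hst)
        right_continuous' := fun t => hgcont.continuousWithinAt }
    have hg : ∀ t, g t = y (max t 0) k := fun t => rfl
    refine ⟨g, hg, ?_⟩
    have hset : {t | ¬(0 ≤ t → (x t + (1 - P.transpose).mulVec (y t)) k = 0)} =
      {t | 0 ≤ t ∧ x t k + (y t k - ∑ l, P l k * y t l) ≠ 0} := by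
      ext t
      simp only [mem_ofPred_eq, Classical.not_imp, hz, ne_eq]
    rw [ae_iff, hset]
    -- The limit path `ζ` is only right continuous, so positivity at `t` spreads only to some `[t,
    -- b]`, where `ζ > ζ t / 2`. For large `n` the approximating paths exceed `ζ t / 4` there,
    -- `hflat` freezes `yn`, and the limit `y` is constant on `[t, b]`.
    refine measure_eq_zero_of_forall_Ico fun t ht => ?_
    obtain ⟨ht0, hne⟩ := ht
    set ζ : ℝ → ℝ := fun t => x t k + (y t k - ∑ l, P l k * y t l) with hζ
    have hζ0 : 0 ≤ ζ t := by
      refine le_of_forall_pos_le_add fun ε hε => ge_of_tendsto ((hztend t k ht0).add_const ε) ?_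
      filter_upwards [happrox t ε hε] with n hn
      have := (hn k t ⟨ht0, le_rfl⟩).2.1 t ⟨ht0, le_rfl⟩
      linarith
    have hpos : 0 < ζ t := lt_of_le_of_ne hζ0 (Ne.symm hne)
    have hrc : ContinuousWithinAt ζ (Ici t) t := by
      have h1 := continuousWithinAt_pi.1 (hx.1 t ht0) k
      have h2 : ∀ l, ContinuousWithinAt (fun t => y t l) (Ici t) t := fun l =>
        (hycont l t ht0).mono (Ici_subset_Ici.2 ht0)
      exact h1.add ((h2 k).sub (tendsto_finsetSum _ fun l _ => (h2 l).const_mul _))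
    have hev : ∀ᶠ s in 𝓝[≥] t, ζ t / 2 < ζ s := hrc.eventually_const_lt (half_lt_self hpos)
    obtain ⟨b, hb, hsub⟩ := mem_nhdsGE_iff_exists_Icc_subset.1 hev
    refine ⟨b, hb, ?_⟩
    have hconst : y b k = y t k := by
      have hη : 0 < ζ t / 4 := by positivity
      have huz : TendstoUOC (fun n r => xn n r k + (yn n r k - ∑ l, P l k * yn n r l)) ζ := by
        have hE : 0 < 1 + 1 + ∑ l, P l k := by
          linarith [Finset.sum_nonneg fun l (_ : l ∈ Finset.univ) => hP l k]
        refine tendstoUOC_of_eventually fun L ε hε => ?_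
        set θ := ε / (1 + 1 + ∑ l, P l k) with hθ
        have hθ0 : 0 < θ := by positivity
        have h1 : ∀ᶠ n in atTop, ∀ l, ∀ t ∈ Icc 0 L, |yn n t l - y t l| ≤ θ :=
          eventually_all.2 fun l => (huoc l).eventually_abs_sub_le L hθ0
        filter_upwards [h1, (hxn k).eventually_abs_sub_le L hθ0] with n hn hn' r hr
        have h2 : |∑ l, P l k * yn n r l - ∑ l, P l k * y r l| ≤ ∑ l, P l k * θ := by
          rw [← Finset.sum_sub_distrib]
          refine (Finset.abs_sum_le_sum_abs _ _).trans (Finset.sum_le_sum fun l _ => ?_)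
          rw [← mul_sub, abs_mul, abs_of_nonneg (hP l k)]
          exact mul_le_mul_of_nonneg_left (hn l r hr) (hP l k)
        have h3 : θ + θ + ∑ l, P l k * θ = ε := by
          rw [← Finset.sum_mul, hθ]; field_simp
        have h4 := abs_le.1 (hn k r hr)
        have h5 := abs_le.1 (hn' r hr)
        have h6 := abs_le.1 h2
        rw [abs_le]
        constructor <;> linarith [h4.1, h4.2, h5.1, h5.2, h6.1, h6.2]
      refine tendsto_nhds_unique (hy b k (ht0.trans hb.le)) ((hy t k ht0).congr' ?_)
      filter_upwards [hflat b _ hη, huz.eventually_abs_sub_le b hη] with n hn hn'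
      refine (hn k t b ht0 hb.le le_rfl fun r hr => ?_).symm
      have h1 := (abs_le.1 (hn' r ⟨ht0.trans hr.1, hr.2⟩)).1
      have h2 : ζ t / 2 < ζ r := hsub hr
      linarith
    have hleft : ∀ s, Function.leftLim g s = g s := fun s =>
      (g.mono.continuousAt_iff_leftLim_eq_rightLim.1 hgcont.continuousAt).trans
        (g.rightLim_eq s)
    rw [g.measure_Ico, hleft, hleft, hg, hg, max_eq_left ht0, max_eq_left (ht0.trans hb.le),
      hconst, sub_self, ENNReal.ofReal_zero]

/-! ### Busy times of right-continuous queue paths. -/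

/-- By right continuity the path is the pointwise limit of its values at the next grid point of mesh
`1 / (n + 1)`, and these factor through `ℕ`. Measurability makes the busy-time integral genuine
rather than the default value 0. -/
theorem IsRCLL.measurable_comp_max {q : ℝ → ℤ} (hq : IsRCLL q) :
    Measurable fun s => q (max s 0) := by
  have hlim : ∀ s : ℝ, Tendsto (fun n : ℕ => ((⌊((n : ℝ) + 1) * max s 0⌋₊ : ℝ) + 1) / ((n : ℝ) + 1))
      atTop (𝓝[≥] (max s 0)) := by
    intro s
    have hpos : ∀ n : ℕ, (0 : ℝ) < (n : ℝ) + 1 := fun n => by positivity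
    have hge : ∀ n : ℕ, max s 0 ≤ ((⌊((n : ℝ) + 1) * max s 0⌋₊ : ℝ) + 1) / ((n : ℝ) + 1) :=
      fun n => by
        rw [le_div_iff₀ (hpos n), mul_comm]
        exact (Nat.lt_floor_add_one _).le
    have hle : ∀ n : ℕ, ((⌊((n : ℝ) + 1) * max s 0⌋₊ : ℝ) + 1) / ((n : ℝ) + 1)
        ≤ max s 0 + 1 / ((n : ℝ) + 1) := fun n => by
      have h1 := Nat.floor_le (mul_nonneg (hpos n).le (le_max_right s 0))
      have h2 : (max s 0 + 1 / ((n : ℝ) + 1)) * ((n : ℝ) + 1) = ((n : ℝ) + 1) * max s 0 + 1 := by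
        have := (hpos n).ne'
        field_simp
      rw [div_le_iff₀ (hpos n), h2]
      linarith
    refine tendsto_nhdsWithin_iff.2 ⟨?_, Eventually.of_forall hge⟩
    refine tendsto_of_tendsto_of_tendsto_of_le_of_le tendsto_const_nhds ?_ hge hle
    simpa using tendsto_one_div_add_atTop_nhds_zero_nat.const_add (max s 0)
  refine measurable_of_tendsto_metrizable (f := fun (n : ℕ) s =>
    q (((⌊((n : ℝ) + 1) * max s 0⌋₊ : ℝ) + 1) / ((n : ℝ) + 1))) (fun n => ?_) ?_
  · have h1 : Measurable fun s : ℝ => ⌊((n : ℝ) + 1) * max s 0⌋₊ :=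
      Nat.measurable_floor.comp ((measurable_id.max measurable_const).const_mul _)
    exact (measurable_from_nat (f := fun m : ℕ => q (((m : ℝ) + 1) / ((n : ℝ) + 1)))).comp h1
  · exact tendsto_pi_nhds.2 fun s => (hq.1 _ (le_max_right s 0)).tendsto.comp (hlim s)

namespace IsRCLL

variable {q : ℝ → ℤ} {s t : ℝ}

theorem intervalIntegrable_busy (hq : IsRCLL q) (hs : 0 ≤ s) (ht : 0 ≤ t) :
    IntervalIntegrable (fun r => if 0 < q r then (1 : ℝ) else 0) volume s t := by
  have hmeas : Measurable fun r => if 0 < q (max r 0) then (1 : ℝ) else 0 :=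
    Measurable.ite (hq.measurable_comp_max measurableSet_Ioi) measurable_const measurable_const
  refine (intervalIntegrable_const (c := (1 : ℝ))).mono_fun
    (hmeas.aestronglyMeasurable.congr ?_) (Eventually.of_forall fun r => ?_)
  · refine (ae_restrict_iff' measurableSet_uIoc).2 (Eventually.of_forall fun r hr => ?_)
    have h0 : 0 ≤ r := (le_min hs ht).trans hr.1.le
    simp only [max_eq_left h0]
  · dsimp only
    split_ifs <;> simp

theorem busyTime_sub (hq : IsRCLL q) (hs : 0 ≤ s) (hst : s ≤ t) :
    busyTime q t - busyTime q s = ∫ r in s..t, if 0 < q r then 1 else 0 :=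
  intervalIntegral.integral_interval_sub_left
    (hq.intervalIntegrable_busy le_rfl (hs.trans hst)) (hq.intervalIntegrable_busy le_rfl hs)

theorem busyTime_mono (hq : IsRCLL q) (hs : 0 ≤ s) (hst : s ≤ t) :
    busyTime q s ≤ busyTime q t := by
  rw [← sub_nonneg, hq.busyTime_sub hs hst]
  refine intervalIntegral.integral_nonneg hst fun r _ => ?_
  split_ifs <;> norm_num

theorem busyTime_sub_le (hq : IsRCLL q) (hs : 0 ≤ s) (hst : s ≤ t) :
    busyTime q t - busyTime q s ≤ t - s := by
  rw [hq.busyTime_sub hs hst]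
  have := intervalIntegral.integral_mono_on hst
    (hq.intervalIntegrable_busy hs (hs.trans hst)) (intervalIntegrable_const (c := (1 : ℝ)))
    fun r _ => by split_ifs <;> norm_num
  simpa using this

theorem busyTime_eq_of_nonpos (hq : IsRCLL q) (hs : 0 ≤ s) (hst : s ≤ t)
    (h : ∀ r ∈ Ioc s t, q r ≤ 0) : busyTime q t = busyTime q s := by
  rw [← sub_eq_zero, hq.busyTime_sub hs hst]
  refine intervalIntegral.integral_zero_ae (Eventually.of_forall fun r hr => ?_)
  rw [uIoc_of_le hst] at hr
  exact if_neg (not_lt.2 (h r hr))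

theorem busyTime_sub_eq_of_pos (hq : IsRCLL q) (hs : 0 ≤ s) (hst : s ≤ t)
    (h : ∀ r ∈ Ioc s t, 0 < q r) : busyTime q t - busyTime q s = t - s := by
  rw [hq.busyTime_sub hs hst, intervalIntegral.integral_congr_ae (g := fun _ => (1 : ℝ))]
  · simp
  · refine Eventually.of_forall fun r hr => ?_
    rw [uIoc_of_le hst] at hr
    exact if_pos (h r hr)

theorem busyTime_zero : busyTime q 0 = 0 := intervalIntegral.integral_same

theorem busyTime_mem (hq : IsRCLL q) (ht : 0 ≤ t) : busyTime q t ∈ Icc 0 t := by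
  have h1 := hq.busyTime_mono le_rfl ht
  have h2 := hq.busyTime_sub_le le_rfl ht
  rw [busyTime_zero] at h1 h2
  exact ⟨h1, by linarith⟩

end IsRCLL

/-! ### Fluid-scale estimates for a single network. -/

namespace TransitoryNetwork

variable {K : ℕ} {Ω : Type*} {N : TransitoryNetwork K Ω}

theorem arrivals_mono (n : ℕ) (k : Fin K) (ω : Ω) : Monotone (N.arrivals n k ω) := by
  intro s t hst
  unfold arrivals
  split_ifs with h
  · exact Finset.card_le_card (Finset.monotone_filter_right _ fun m _ hm => hm.trans hst)
  · exact le_rfl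

theorem routed_mono (l k : Fin K) (ω : Ω) : Monotone (N.routed l k ω) := fun _ _ h =>
  Finset.card_le_card (Finset.filter_subset_filter _ (Finset.range_mono h))

namespace IsQueuePath

variable {n : ℕ} {ω : Ω} {q : Fin K → ℝ → ℤ} {μ : Fin K → ℝ} {θ L : ℝ}

/-- Arrivals and routed input only increase, so a queue can drop only through its own departures. -/
theorem sub_service_le (hq : N.IsQueuePath n ω q)
    (hmono : ∀ k, MonotoneOn (N.service n k ω) (Ici 0)) (k : Fin K) {s t : ℝ} (hs : 0 ≤ s)
    (hst : s ≤ t) :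
    q k s - ((N.service n k ω (busyTime (q k) t) : ℤ) - N.service n k ω (busyTime (q k) s))
      ≤ q k t := by
  have h1 := arrivals_mono (N := N) n k ω hst
  have h2 : ∑ l, (N.routed l k ω (N.service n l ω (busyTime (q l) s)) : ℤ)
      ≤ ∑ l, (N.routed l k ω (N.service n l ω (busyTime (q l) t)) : ℤ) :=
    Finset.sum_le_sum fun l _ => by
      have := routed_mono (N := N) l k ω (hmono l ((hq.rcll l).busyTime_mem hs).1
        ((hq.rcll l).busyTime_mem (hs.trans hst)).1 ((hq.rcll l).busyTime_mono hs hst))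
      exact_mod_cast this
  rw [hq.balance s hs k, hq.balance t (hs.trans hst) k]
  have h3 : (N.arrivals n k ω s : ℤ) ≤ N.arrivals n k ω t := by exact_mod_cast h1
  linarith

/-- Queue lengths are nonnegative up to the size of the service batches. -/
theorem neg_le_div (hq : N.IsQueuePath n ω q) (hn : 0 < n)
    (hmono : ∀ k, MonotoneOn (N.service n k ω) (Ici 0)) (hzero : ∀ k, N.service n k ω 0 = 0)
    (hμ : ∀ k, 0 < μ k) (hθ : 0 ≤ θ)
    (hS : ∀ k, ∀ b ∈ Icc 0 L, |(N.service n k ω b : ℝ) / n - μ k * b| ≤ θ)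
    (k : Fin K) {t : ℝ} (ht : t ∈ Icc 0 L) : -(2 * θ) ≤ (q k t : ℝ) / n := by
  have hn' : (0 : ℝ) < n := by exact_mod_cast hn
  have hk := hq.rcll k
  rcases {u ∈ Icc 0 t | 0 < q k u}.eq_empty_or_nonempty with he | hne
  · have hflat : busyTime (q k) t = busyTime (q k) 0 :=
      hk.busyTime_eq_of_nonpos le_rfl ht.1 fun r hr => by
        by_contra! hlt
        exact (he ▸ (show r ∈ {u ∈ Icc 0 t | 0 < q k u} from ⟨⟨hr.1.le, hr.2⟩, hlt⟩) :
          r ∈ (∅ : Set ℝ))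
    have hnn : 0 ≤ q k t := by
      rw [hq.balance t ht.1 k, hflat, IsRCLL.busyTime_zero, hzero, Nat.cast_zero, sub_zero]
      exact add_nonneg (Nat.cast_nonneg _) (Finset.sum_nonneg fun l _ => Nat.cast_nonneg _)
    have : (0 : ℝ) ≤ (q k t : ℝ) / n := div_nonneg (by exact_mod_cast hnn) hn'.le
    linarith
  · have hbdd : BddAbove {u ∈ Icc 0 t | 0 < q k u} := ⟨t, fun u hu => hu.1.2⟩
    set σ := sSup {u ∈ Icc 0 t | 0 < q k u} with hσ
    have hσt : σ ≤ t := csSup_le hne fun u hu => hu.1.2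
    -- The supremum `σ` need not be attained, so a time `u` with positive queue is taken just before
    -- it. The server is idle after `σ`, so less than `1 / (n μ_k)` of busy time separates `u` from
    -- `t`. The resulting scaled departures, at most `1 / n + 2θ`, are offset up to `2θ` by the job
    -- present at `u`.
    have hδ : 0 < 1 / (n * μ k) := by have := hμ k; positivity
    obtain ⟨u, hu, hlt⟩ := exists_lt_of_lt_csSup hne (sub_lt_self σ hδ)
    have huσ : u ≤ σ := le_csSup hbdd hu
    have hflat : busyTime (q k) t = busyTime (q k) σ :=
      hk.busyTime_eq_of_nonpos (hu.1.1.trans huσ) hσt fun r hr => by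
        by_contra! hpos
        exact absurd (le_csSup hbdd ⟨⟨(hu.1.1.trans huσ).trans hr.1.le, hr.2⟩, hpos⟩)
          (not_le.2 hr.1)
    have h1 := hk.busyTime_sub_le hu.1.1 huσ
    have hmem : ∀ r ∈ Icc 0 t, busyTime (q k) r ∈ Icc 0 L := fun r hr =>
      ⟨(hk.busyTime_mem hr.1).1, (hk.busyTime_mem hr.1).2.trans (hr.2.trans ht.2)⟩
    have h2 := abs_le.1 (hS k _ (hmem t ⟨ht.1, le_rfl⟩))
    have h3 := abs_le.1 (hS k _ (hmem u hu.1))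
    have h4 : ((q k u - ((N.service n k ω (busyTime (q k) t) : ℤ)
        - N.service n k ω (busyTime (q k) u)) : ℤ) : ℝ) ≤ q k t :=
      Int.cast_le.2 (hq.sub_service_le hmono k hu.1.1 hu.1.2)
    have h5 : (1 : ℝ) ≤ q k u := by exact_mod_cast hu.2
    push_cast at h4
    have h6 := div_le_div_of_nonneg_right h4 hn'.le
    have h7 := div_le_div_of_nonneg_right h5 hn'.le
    rw [sub_div, sub_div] at h6
    have h8 : μ k * (busyTime (q k) t - busyTime (q k) u) ≤ 1 / n := by
      have h9 : busyTime (q k) t - busyTime (q k) u ≤ 1 / (n * μ k) := by linarith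
      refine (mul_le_mul_of_nonneg_left h9 (hμ k).le).trans (le_of_eq ?_)
      have := (hμ k).ne'
      field_simp
    rw [mul_sub] at h8
    linarith [h2.2, h3.1]

/-- A scaled queue length is close to the corresponding linear function of the busy times. -/
theorem abs_div_sub_le (hq : N.IsQueuePath n ω q) (hn : 0 < n) (hP : ∀ i j, 0 ≤ N.P i j)
    (hμ : ∀ k, 0 < μ k) {L' : ℝ} (hL' : ∀ k, μ k * L + θ ≤ L')
    (hS : ∀ k, ∀ b ∈ Icc 0 L, |(N.service n k ω b : ℝ) / n - μ k * b| ≤ θ)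
    (hR : ∀ l k, ∀ b ∈ Icc 0 L',
      |(N.routed l k ω ⌊(n : ℝ) * b⌋₊ : ℝ) / n - N.P l k * b| ≤ θ)
    (k : Fin K) {t : ℝ} (ht : t ∈ Icc 0 L) :
    |(q k t : ℝ) / n - ((N.arrivals n k ω t : ℝ) / n
      + ∑ l, N.P l k * (μ l * busyTime (q l) t) - μ k * busyTime (q k) t)|
      ≤ (1 + ∑ l, (1 + N.P l k)) * θ := by
  have hn' : (0 : ℝ) < n := by exact_mod_cast hn
  have hmem : ∀ l, busyTime (q l) t ∈ Icc 0 L := fun l =>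
    ⟨((hq.rcll l).busyTime_mem ht.1).1, ((hq.rcll l).busyTime_mem ht.1).2.trans ht.2⟩
  have hroute : ∀ l, |(N.routed l k ω (N.service n l ω (busyTime (q l) t)) : ℝ) / n
      - N.P l k * (μ l * busyTime (q l) t)| ≤ (1 + N.P l k) * θ := by
    intro l
    set m := N.service n l ω (busyTime (q l) t) with hm
    have h1 := abs_le.1 (hS l _ (hmem l))
    rw [← hm] at h1
    have h2 : μ l * busyTime (q l) t ≤ μ l * L :=
      mul_le_mul_of_nonneg_left (hmem l).2 (hμ l).le
    -- The routing law is evaluated at the random time `m / n`; the service estimate keeps it below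
    -- `μ l * L + θ ≤ L'`.
    have h3 := hR l k ((m : ℝ) / n) ⟨by positivity, by linarith [hL' l, h1.2]⟩
    rw [mul_div_cancel₀ _ hn'.ne', Nat.floor_natCast] at h3
    have h4 : |N.P l k * ((m : ℝ) / n) - N.P l k * (μ l * busyTime (q l) t)| ≤ N.P l k * θ := by
      rw [← mul_sub, abs_mul, abs_of_nonneg (hP l k)]
      exact mul_le_mul_of_nonneg_left (abs_le.2 h1) (hP l k)
    have := abs_sub_le ((N.routed l k ω m : ℝ) / n) (N.P l k * ((m : ℝ) / n))
      (N.P l k * (μ l * busyTime (q l) t))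
    linarith
  have hdecomp : (q k t : ℝ) / n - ((N.arrivals n k ω t : ℝ) / n
      + ∑ l, N.P l k * (μ l * busyTime (q l) t) - μ k * busyTime (q k) t)
      = ∑ l, ((N.routed l k ω (N.service n l ω (busyTime (q l) t)) : ℝ) / n
        - N.P l k * (μ l * busyTime (q l) t))
        - ((N.service n k ω (busyTime (q k) t) : ℝ) / n - μ k * busyTime (q k) t) := by
    rw [hq.balance t ht.1 k, Finset.sum_sub_distrib, ← Finset.sum_div]
    push_cast
    ring
  rw [hdecomp]
  refine (abs_sub _ _).trans ?_
  have h1 := (Finset.abs_sum_le_sum_abs (fun l =>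
    (N.routed l k ω (N.service n l ω (busyTime (q l) t)) : ℝ) / n
      - N.P l k * (μ l * busyTime (q l) t)) Finset.univ).trans
    (Finset.sum_le_sum fun l _ => hroute l)
  rw [← Finset.sum_mul] at h1
  have h2 := hS k _ (hmem k)
  linarith

end IsQueuePath

/-- The scaled cumulative idle times `μ_k (t - B_k(t))`. -/
noncomputable def idle (μ : Fin K → ℝ) (q : Fin K → ℝ → ℤ) (t : ℝ) (k : Fin K) : ℝ :=
  μ k * (t - busyTime (q k) t)

/-- The scaled netput of the `n`-th network. -/
noncomputable def scaledNetput (N : TransitoryNetwork K Ω) (μ : Fin K → ℝ) (n : ℕ) (ω : Ω) (t : ℝ)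
    (k : Fin K) : ℝ :=
  (N.arrivals n k ω t : ℝ) / n - μ k * t + ∑ l, N.P l k * (μ l * t)

theorem scaledNetput_add_idle (μ : Fin K → ℝ) (n : ℕ) (ω : Ω) (q : Fin K → ℝ → ℤ) (t : ℝ)
    (k : Fin K) :
    N.scaledNetput μ n ω t k + (idle μ q t k - ∑ l, N.P l k * idle μ q t l)
      = (N.arrivals n k ω t : ℝ) / n + ∑ l, N.P l k * (μ l * busyTime (q l) t)
        - μ k * busyTime (q k) t := by
  have h : ∑ l, N.P l k * idle μ q t l
      = ∑ l, N.P l k * (μ l * t) - ∑ l, N.P l k * (μ l * busyTime (q l) t) := by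
    rw [← Finset.sum_sub_distrib]
    exact Finset.sum_congr rfl fun l _ => by unfold idle; ring
  rw [h, scaledNetput, idle]
  ring

namespace IsQueuePath

variable {n : ℕ} {ω : Ω} {q : Fin K → ℝ → ℤ} {μ : Fin K → ℝ} {θ L L' : ℝ}

/-- Near-nonnegativity of the queue gives the inequality for all `s`. For the near-attainment, go
back to the last time the queue was not positive: idle time has not grown since. If there was no
such time, no idle time has accrued. -/
theorem isApproxRegulator (hq : N.IsQueuePath n ω q) (hn : 0 < n) (hP : ∀ i j, 0 ≤ N.P i j)
    (hmono : ∀ k, MonotoneOn (N.service n k ω) (Ici 0)) (hzero : ∀ k, N.service n k ω 0 = 0)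
    (hμ : ∀ k, 0 < μ k) (hθ : 0 < θ) (hL' : ∀ k, μ k * L + θ ≤ L')
    (hS : ∀ k, ∀ b ∈ Icc 0 L, |(N.service n k ω b : ℝ) / n - μ k * b| ≤ θ)
    (hR : ∀ l k, ∀ b ∈ Icc 0 L',
      |(N.routed l k ω ⌊(n : ℝ) * b⌋₊ : ℝ) / n - N.P l k * b| ≤ θ)
    {ε : ℝ} (hε : ∀ k, (1 + ∑ l, (1 + N.P l k)) * θ + 2 * θ ≤ ε) :
    IsApproxRegulator N.P ε L (N.scaledNetput μ n ω) (idle μ q) := by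
  have hn' : (0 : ℝ) < n := by exact_mod_cast hn
  intro k t ht
  have hk := hq.rcll k
  have herr : ∀ s ∈ Icc 0 L, |(q k s : ℝ) / n - (N.scaledNetput μ n ω s k
      + (idle μ q s k - ∑ l, N.P l k * idle μ q s l))| ≤ (1 + ∑ l, (1 + N.P l k)) * θ :=
    fun s hs => by
      rw [scaledNetput_add_idle]
      exact hq.abs_div_sub_le hn hP hμ hL' hS hR k hs
  have hidle : ∀ s r, 0 ≤ s → s ≤ r → idle μ q s k ≤ idle μ q r k := fun s r hs hsr =>
    mul_le_mul_of_nonneg_left (by linarith [hk.busyTime_sub_le hs hsr]) (hμ k).le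
  have hE : 0 ≤ (1 + ∑ l, (1 + N.P l k)) * θ := (abs_nonneg _).trans (herr t ht)
  refine ⟨mul_nonneg (hμ k).le (by linarith [(hk.busyTime_mem ht.1).2]), fun s hs => ?_, ?_⟩
  · have hsL : s ∈ Icc 0 L := ⟨hs.1, hs.2.trans ht.2⟩
    have h1 := (abs_le.1 (herr s hsL)).2
    have h2 := hq.neg_le_div hn hmono hzero hμ hθ.le hS k hsL
    have h3 := hidle s t hs.1 hs.2
    linarith [hε k]
  · rcases {u ∈ Icc 0 t | q k u ≤ 0}.eq_empty_or_nonempty with he | hne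
    · left
      have hfull := hk.busyTime_sub_eq_of_pos le_rfl ht.1 fun r hr => by
        by_contra! hle
        exact (he ▸ (show r ∈ {u ∈ Icc 0 t | q k u ≤ 0} from ⟨⟨hr.1.le, hr.2⟩, hle⟩) :
          r ∈ (∅ : Set ℝ))
      rw [IsRCLL.busyTime_zero, sub_zero, sub_zero] at hfull
      rw [idle, hfull, sub_self, mul_zero]
      linarith [hε k]
    · right
      have hbdd : BddAbove {u ∈ Icc 0 t | q k u ≤ 0} := ⟨t, fun u hu => hu.1.2⟩
      set σ := sSup {u ∈ Icc 0 t | q k u ≤ 0} with hσ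
      have hσt : σ ≤ t := csSup_le hne fun u hu => hu.1.2
      -- As the supremum may not be attained, `u` is chosen within `θ / μ k` of it, which costs at
      -- most `θ` of scaled idle time.
      have hδ : 0 < θ / μ k := div_pos hθ (hμ k)
      obtain ⟨u, hu, hlt⟩ := exists_lt_of_lt_csSup hne (sub_lt_self σ hδ)
      have huσ : u ≤ σ := le_csSup hbdd hu
      have hfull := hk.busyTime_sub_eq_of_pos (hu.1.1.trans huσ) hσt fun r hr => by
        by_contra! hle
        exact absurd (le_csSup hbdd ⟨⟨(hu.1.1.trans huσ).trans hr.1.le, hr.2⟩, hle⟩)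
          (not_le.2 hr.1)
      have h1 := hk.busyTime_mono hu.1.1 huσ
      have h2 : idle μ q t k ≤ idle μ q u k + θ := by
        have h3 : t - busyTime (q k) t ≤ (u - busyTime (q k) u) + θ / μ k := by linarith
        refine (mul_le_mul_of_nonneg_left h3 (hμ k).le).trans (le_of_eq ?_)
        rw [mul_add, mul_div_cancel₀ _ (hμ k).ne', idle]
      have h4 := (abs_le.1 (herr u ⟨hu.1.1, hu.1.2.trans ht.2⟩)).1
      have h5 : (q k u : ℝ) / n ≤ 0 :=
        div_nonpos_of_nonpos_of_nonneg (by exact_mod_cast hu.2) hn'.le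
      exact ⟨u, hu.1, by linarith [hε k]⟩

/-- Where the regulated path exceeds the approximation error, the actual queue is positive and the
server never idles. -/
theorem idle_eq (hq : N.IsQueuePath n ω q) (hn : 0 < n) (hP : ∀ i j, 0 ≤ N.P i j)
    (hμ : ∀ k, 0 < μ k) (hL' : ∀ k, μ k * L + θ ≤ L')
    (hS : ∀ k, ∀ b ∈ Icc 0 L, |(N.service n k ω b : ℝ) / n - μ k * b| ≤ θ)
    (hR : ∀ l k, ∀ b ∈ Icc 0 L',
      |(N.routed l k ω ⌊(n : ℝ) * b⌋₊ : ℝ) / n - N.P l k * b| ≤ θ)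
    {k : Fin K} {s t : ℝ} (hs : 0 ≤ s) (hst : s ≤ t) (ht : t ≤ L)
    (h : ∀ r ∈ Icc s t, (1 + ∑ l, (1 + N.P l k)) * θ < N.scaledNetput μ n ω r k
      + (idle μ q r k - ∑ l, N.P l k * idle μ q r l)) :
    idle μ q t k = idle μ q s k := by
  have hn' : (0 : ℝ) < n := by exact_mod_cast hn
  have := (hq.rcll k).busyTime_sub_eq_of_pos hs hst fun r hr => by
    have h1 := h r ⟨hr.1.le, hr.2⟩
    rw [scaledNetput_add_idle] at h1
    have h2 := (abs_le.1 (hq.abs_div_sub_le hn hP hμ hL' hS hR k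
      ⟨hs.trans hr.1.le, hr.2.trans ht⟩)).1
    have h3 : 0 < (q k r : ℝ) / n := by linarith
    have h4 := (div_pos_iff_of_pos_right hn').1 h3
    exact_mod_cast h4
  rw [idle, idle]
  congr 1
  linarith

end IsQueuePath

end TransitoryNetwork

/-! ### Uniform convergence of empirical distribution functions. -/

section GlivenkoCantelli

variable {Ω : Type*} [MeasurableSpace Ω] {Pr : Measure Ω} [IsProbabilityMeasure Pr]
  {X : ℕ → Ω → ℝ}

theorem ae_tendsto_sum_indicator_div (hX : ∀ m, Measurable (X m))
    (hindep : Pairwise fun i j => IndepFun (X i) (X j) Pr)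
    (hident : ∀ m, IdentDistrib (X m) (X 0) Pr Pr) {s : Set ℝ} (hs : MeasurableSet s) :
    ∀ᵐ ω ∂Pr, Tendsto
      (fun n : ℕ => (∑ m ∈ Finset.range n, s.indicator (fun _ => (1 : ℝ)) (X m ω)) / n) atTop
      (𝓝 ((Pr.map (X 0)).real s)) := by
  have hg : Measurable (s.indicator fun _ => (1 : ℝ)) := measurable_const.indicator hs
  have hint : Integrable ((s.indicator fun _ => (1 : ℝ)) ∘ X 0) Pr := by
    refine (integrable_const (1 : ℝ)).mono (hg.comp (hX 0)).aestronglyMeasurable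
      (Eventually.of_forall fun ω => ?_)
    simp only [Function.comp_apply, indicator]
    split_ifs <;> simp
  have hlaw := strong_law_ae_real (μ := Pr) (fun m => (s.indicator fun _ => (1 : ℝ)) ∘ X m) hint
    (fun i j hij => (hindep hij).comp hg hg) fun m => (hident m).comp hg
  have hmean : ∫ ω, ((s.indicator fun _ => (1 : ℝ)) ∘ X 0) ω ∂Pr = (Pr.map (X 0)).real s := by
    simp only [Function.comp_apply]
    rw [← integral_map (hX 0).aemeasurable hg.aestronglyMeasurable, integral_indicator_const _ hs]
    simp
  rw [hmean] at hlaw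
  exact hlaw

theorem exists_rat_lt_sub_lt (F : StieltjesFunction ℝ) (x : ℝ) {θ : ℝ} (hθ : 0 < θ) :
    ∃ a : ℚ, (a : ℝ) < x ∧ Function.leftLim F x - F a < θ := by
  have h : ∀ᶠ s in 𝓝[<] x, Function.leftLim F x - θ < F s :=
    (F.mono.tendsto_leftLim x).eventually_const_lt (by linarith)
  obtain ⟨l, hl, hsub⟩ := mem_nhdsLT_iff_exists_Ioo_subset.1 h
  obtain ⟨a, hla, hax⟩ := exists_rat_btwn (mem_Iio.1 hl)
  have h1 : Function.leftLim F x - θ < F a := hsub ⟨hla, hax⟩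
  exact ⟨a, hax, by linarith⟩

theorem exists_rat_gt_sub_lt (F : StieltjesFunction ℝ) (x : ℝ) {θ : ℝ} (hθ : 0 < θ) :
    ∃ b : ℚ, x < (b : ℝ) ∧ F b - F x < θ := by
  have h : ∀ᶠ s in 𝓝[≥] x, F s < F x + θ :=
    (F.right_continuous x).eventually_lt_const (by linarith)
  obtain ⟨r, hr, hsub⟩ := mem_nhdsGE_iff_exists_Ico_subset.1 h
  obtain ⟨b, hxb, hbr⟩ := exists_rat_btwn (mem_Ioi.1 hr)
  have h1 : F b < F x + θ := hsub ⟨hxb.le, hbr⟩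
  exact ⟨b, hxb, by linarith⟩

theorem abs_sub_lt_of_squeeze {a α β f φ ψ ε : ℝ} (h1 : α ≤ a) (h2 : a ≤ β) (h3 : φ ≤ f)
    (h4 : f ≤ ψ) (h5 : |α - φ| < ε / 3) (h6 : |β - ψ| < ε / 3) (h7 : ψ - φ < 2 * (ε / 3)) :
    |f - a| < ε := by
  rw [abs_lt] at *
  constructor <;> linarith [h5.1, h5.2, h6.1, h6.2]

/-- The **Glivenko-Cantelli theorem**, on compact sets. -/
theorem ae_tendstoUOC_empiricalCDF (hX : ∀ m, Measurable (X m))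
    (hindep : Pairwise fun i j => IndepFun (X i) (X j) Pr)
    (hident : ∀ m, IdentDistrib (X m) (X 0) Pr Pr) :
    ∀ᵐ ω ∂Pr, TendstoUOC
      (fun n t => (((Finset.range n).filter fun m => X m ω ≤ t).card : ℝ) / n)
      (fun t => cdf (Pr.map (X 0)) t) := by
  have : IsProbabilityMeasure (Pr.map (X 0)) :=
    Measure.isProbabilityMeasure_map (hX 0).aemeasurable
  set ν := Pr.map (X 0) with hν
  have hIio : ∀ x, ν.real (Iio x) = Function.leftLim (cdf ν) x := by
    intro x
    have h1 := (cdf ν).measure_Iio (tendsto_cdf_atBot ν) x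
    rw [measure_cdf, sub_zero] at h1
    rw [Measure.real, h1, ENNReal.toReal_ofReal]
    exact ge_of_tendsto ((monotone_cdf ν).tendsto_leftLim x)
      (Eventually.of_forall fun s => cdf_nonneg ν s)
  -- A monotone function has countably many jumps, so the strong law holds off one null set at all
  -- rationals and, for both `Iic` and `Iio`, at all jumps.
  have hC : {x | ¬ContinuousAt (cdf ν) x}.Countable := (monotone_cdf ν).countable_not_continuousAt
  have hrat : ∀ᵐ ω ∂Pr, ∀ a : ℚ, Tendsto
      (fun n : ℕ => (∑ m ∈ Finset.range n, (Iic (a : ℝ)).indicator (fun _ => (1 : ℝ)) (X m ω)) / n)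
      atTop (𝓝 (ν.real (Iic (a : ℝ)))) :=
    ae_all_iff.2 fun a => ae_tendsto_sum_indicator_div hX hindep hident measurableSet_Iic
  have hjump : ∀ᵐ ω ∂Pr, ∀ x ∈ {x | ¬ContinuousAt (cdf ν) x}, Tendsto
      (fun n : ℕ => (∑ m ∈ Finset.range n, (Iic x).indicator (fun _ => (1 : ℝ)) (X m ω)) / n)
      atTop (𝓝 (ν.real (Iic x))) :=
    (ae_ball_iff hC).2 fun x _ => ae_tendsto_sum_indicator_div hX hindep hident measurableSet_Iic
  have hjump' : ∀ᵐ ω ∂Pr, ∀ x ∈ {x | ¬ContinuousAt (cdf ν) x}, Tendsto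
      (fun n : ℕ => (∑ m ∈ Finset.range n, (Iio x).indicator (fun _ => (1 : ℝ)) (X m ω)) / n)
      atTop (𝓝 (ν.real (Iio x))) :=
    (ae_ball_iff hC).2 fun x _ => ae_tendsto_sum_indicator_div hX hindep hident measurableSet_Iio
  filter_upwards [hrat, hjump, hjump'] with ω h1 h2 h3
  obtain ⟨A, hA⟩ : ∃ A : ℕ → Set ℝ → ℝ, ∀ n s,
      A n s = (∑ m ∈ Finset.range n, s.indicator (fun _ => (1 : ℝ)) (X m ω)) / n :=
    ⟨_, fun _ _ => rfl⟩
  have hcdf : (fun (n : ℕ) t => (((Finset.range n).filter fun m => X m ω ≤ t).card : ℝ) / n)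
      = fun n t => A n (Iic t) := by
    ext n t
    simp [hA, indicator]
  have hmono : ∀ (n : ℕ) {s t : Set ℝ}, s ⊆ t → A n s ≤ A n t := fun n s t hst => by
    rw [hA, hA]
    exact div_le_div_of_nonneg_right (Finset.sum_le_sum fun m _ =>
      indicator_le_indicator_of_subset hst (fun _ => zero_le_one) _) n.cast_nonneg
  simp only [← hA] at h1 h2 h3
  rw [hcdf]
  intro L
  refine (tendstoLocallyUniformlyOn_iff_tendstoUniformlyOn_of_compact isCompact_Icc).1
    (Metric.tendstoLocallyUniformlyOn_iff.2 fun ε hε x _ => ?_)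
  have hθ : 0 < ε / 3 := by positivity
  obtain ⟨a, hax, ha⟩ := exists_rat_lt_sub_lt (cdf ν) x hθ
  obtain ⟨b, hxb, hb⟩ := exists_rat_gt_sub_lt (cdf ν) x hθ
  refine ⟨Ioo a b, mem_nhdsWithin_of_mem_nhds (Ioo_mem_nhds hax hxb), ?_⟩
  have hev : ∀ {s : Set ℝ}, Tendsto (fun n => A n s) atTop (𝓝 (ν.real s)) →
      ∀ᶠ n in atTop, |A n s - ν.real s| < ε / 3 :=
    fun h => by simpa [Real.dist_eq] using Metric.tendsto_nhds.1 h _ hθ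
  have hF := monotone_cdf ν
  -- At a continuity point one bracket `a < x < b` has oscillation below `2ε / 3`. At a jump the two
  -- sides are bracketed separately, by `a` and `x-` and by `x` and `b`.
  by_cases hx : ContinuousAt (cdf ν) x
  · have hleft : Function.leftLim (cdf ν) x = cdf ν x :=
      (hF.continuousAt_iff_leftLim_eq_rightLim.1 hx).trans ((cdf ν).rightLim_eq x)
    filter_upwards [hev (h1 a), hev (h1 b)] with n hna hnb t ht
    rw [← cdf_eq_real] at hna hnb
    rw [Real.dist_eq]
    exact abs_sub_lt_of_squeeze (hmono n (Iic_subset_Iic.2 ht.1.le))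
      (hmono n (Iic_subset_Iic.2 ht.2.le)) (hF ht.1.le) (hF ht.2.le) hna hnb (by linarith)
  · filter_upwards [hev (h1 a), hev (h1 b), hev (h2 x hx), hev (h3 x hx)]
      with n hna hnb hnx hnx' t ht
    rw [← cdf_eq_real] at hna hnb hnx
    rw [hIio] at hnx'
    rw [Real.dist_eq]
    rcases lt_or_ge t x with htx | htx
    · exact abs_sub_lt_of_squeeze (hmono n (Iic_subset_Iic.2 ht.1.le))
        (hmono n fun s hs => lt_of_le_of_lt hs htx) (hF ht.1.le) (hF.le_leftLim htx) hna hnx'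
        (by linarith)
    · exact abs_sub_lt_of_squeeze (hmono n (Iic_subset_Iic.2 htx))
        (hmono n (Iic_subset_Iic.2 ht.2.le)) (hF htx) (hF ht.2.le) hnx hnb (by linarith)

end GlivenkoCantelli

/-! ### Passage to the limit in the network. -/

namespace TransitoryNetwork

variable {K : ℕ} {Ω : Type*} [MeasurableSpace Ω] {N : TransitoryNetwork K Ω} {Pr : Measure Ω}

theorem arrivalCDF_eq_cdf [IsProbabilityMeasure Pr] (hN : N.IsModel Pr)
    {k : Fin K} (hk : k ∈ N.entry) :
    N.arrivalCDF Pr k = cdf (Pr.map fun ω => N.epoch 0 ω ⟨k, hk⟩) := by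
  have hmeas : Measurable fun ω => N.epoch 0 ω ⟨k, hk⟩ :=
    (measurable_pi_apply _).comp (hN.measurable_epoch 0)
  have : IsProbabilityMeasure (Pr.map fun ω => N.epoch 0 ω ⟨k, hk⟩) :=
    Measure.isProbabilityMeasure_map hmeas.aemeasurable
  ext t
  rw [cdf_eq_real, map_measureReal_apply hmeas measurableSet_Iic, arrivalCDF, dif_pos hk]
  rfl

theorem ae_tendstoUOC_arrivals [IsProbabilityMeasure Pr] (hN : N.IsModel Pr) (k : Fin K) :
    ∀ᵐ ω ∂Pr, TendstoUOC (fun n t => (N.arrivals n k ω t : ℝ) / n) (N.arrivalCDF Pr k) := by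
  by_cases hk : k ∈ N.entry
  · rw [arrivalCDF_eq_cdf hN hk]
    simp only [arrivals, dif_pos hk]
    exact ae_tendstoUOC_empiricalCDF (X := fun m ω => N.epoch m ω ⟨k, hk⟩)
      (fun m => (measurable_pi_apply _).comp (hN.measurable_epoch m))
      (fun i j hij => (hN.indep_epoch.indepFun hij).comp (measurable_pi_apply _)
        (measurable_pi_apply _)) fun m => hN.ident_epoch m ⟨k, hk⟩
  · refine Eventually.of_forall fun ω => tendstoUOC_of_eventually fun L ε hε =>
      Eventually.of_forall fun n t _ => ?_
    simp [arrivals, arrivalCDF, hk, hε.le]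

theorem isRCLL_arrivalCDF [IsProbabilityMeasure Pr] (hN : N.IsModel Pr) (k : Fin K) :
    IsRCLL (N.arrivalCDF Pr k) := by
  by_cases hk : k ∈ N.entry
  · rw [arrivalCDF_eq_cdf hN hk]
    exact ⟨fun t _ => (cdf _).right_continuous t, fun t _ =>
      ⟨_, (monotone_cdf _).tendsto_leftLim t⟩⟩
  · have : N.arrivalCDF Pr k = fun _ => 0 := funext fun t => by simp [arrivalCDF, hk]
    rw [this]
    exact continuousOn_const.isRCLL

theorem fluidNetput_const (μ : Fin K → ℝ) (t : ℝ) (k : Fin K) :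
    N.fluidNetput Pr (fun k _ => μ k) t k
      = N.arrivalCDF Pr k t + (∑ l, N.P l k * (μ l * t) - μ k * t) := by
  simp only [fluidNetput, intervalIntegral.integral_const, smul_eq_mul, sub_zero, mul_comm t]
  ring

theorem isRCLL_fluidNetput [IsProbabilityMeasure Pr] (hN : N.IsModel Pr) (μ : Fin K → ℝ) :
    IsRCLL (N.fluidNetput Pr fun k _ => μ k) := by
  refine isRCLL_pi fun k => ?_
  simp only [fluidNetput_const]
  refine (isRCLL_arrivalCDF hN k).add (Continuous.continuousOn ?_).isRCLL
  fun_prop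

theorem P_nonneg (hN : N.IsModel Pr) (i j : Fin K) : 0 ≤ N.P i j := by
  rw [← hN.route_prob i 0 j]
  exact measureReal_nonneg

theorem tendstoUOC_scaledNetput {μ : Fin K → ℝ} {ω : Ω} {k : Fin K}
    (h : TendstoUOC (fun n t => (N.arrivals n k ω t : ℝ) / n) (N.arrivalCDF Pr k)) :
    TendstoUOC (fun n t => N.scaledNetput μ n ω t k)
      fun t => N.fluidNetput Pr (fun k _ => μ k) t k := by
  refine tendstoUOC_of_eventually fun L ε hε => ?_
  filter_upwards [h.eventually_abs_sub_le L hε] with n hn t ht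
  have h1 : N.scaledNetput μ n ω t k - N.fluidNetput Pr (fun k _ => μ k) t k
      = (N.arrivals n k ω t : ℝ) / n - N.arrivalCDF Pr k t := by
    rw [fluidNetput_const, scaledNetput]
    ring
  rw [h1]
  exact hn t ht

/-- Along a sample path obeying the functional laws of large numbers, the scaled idle times
converge to the regulator of the fluid netput. -/
theorem exists_isObliqueReflection [IsProbabilityMeasure Pr] (hN : N.IsModel Pr)
    {μ : Fin K → ℝ} (hμ : ∀ k, 0 < μ k)
    {ω : Ω} {q : ℕ → Fin K → ℝ → ℤ} (hq : ∀ n, N.IsQueuePath n ω (q n))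
    (hA : ∀ k, TendstoUOC (fun n t => (N.arrivals n k ω t : ℝ) / n) (N.arrivalCDF Pr k))
    (hS : ∀ k, TendstoUOC (fun n t => (N.service n k ω t : ℝ) / n) fun t => μ k * t)
    (hR : ∀ l k, TendstoUOC (fun n t => (N.routed l k ω ⌊(n : ℝ) * t⌋₊ : ℝ) / n)
      fun t => N.P l k * t) :
    ∃ y, IsObliqueReflection N.reflectionMatrix (N.fluidNetput Pr fun k _ => μ k)
        (fun t => N.fluidNetput Pr (fun k _ => μ k) t + N.reflectionMatrix.mulVec (y t)) y ∧
      ∀ k, TendstoUOC (fun n t => idle μ (q n) t k) fun t => y t k := by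
  have hP := P_nonneg hN
  -- A single constant dominating the error factors of all nodes, so that one `θ` serves every `k`.
  set E := ∑ k, (1 + ∑ l, (1 + N.P l k)) with hE
  have hE1 : ∀ k, 0 ≤ 1 + ∑ l, (1 + N.P l k) := fun k => by
    linarith [Finset.sum_nonneg fun l (_ : l ∈ Finset.univ) =>
      (by linarith [hP l k] : 0 ≤ 1 + N.P l k)]
  have hEk : ∀ k, 1 + ∑ l, (1 + N.P l k) ≤ E := fun k =>
    Finset.single_le_sum (f := fun k => 1 + ∑ l, (1 + N.P l k)) (fun k _ => hE1 k)
      (Finset.mem_univ k)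
  have hE0 : 0 ≤ E := Finset.sum_nonneg fun k _ => hE1 k
  have hgood : ∀ L θ : ℝ, 0 < θ → ∃ L', (∀ k, μ k * L + θ ≤ L') ∧ ∀ᶠ n in atTop, 0 < n ∧
      (∀ k, ∀ b ∈ Icc 0 L, |(N.service n k ω b : ℝ) / n - μ k * b| ≤ θ) ∧
      ∀ l k, ∀ b ∈ Icc 0 L', |(N.routed l k ω ⌊(n : ℝ) * b⌋₊ : ℝ) / n - N.P l k * b| ≤ θ := by
    intro L θ hθ
    refine ⟨∑ k, |μ k * L + θ|, fun k => (le_abs_self _).trans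
      (Finset.single_le_sum (f := fun k => |μ k * L + θ|) (fun k _ => abs_nonneg _)
        (Finset.mem_univ k)), ?_⟩
    exact (eventually_gt_atTop 0).and ((eventually_all.2 fun k =>
      (hS k).eventually_abs_sub_le L hθ).and (eventually_all.2 fun l => eventually_all.2 fun k =>
        (hR l k).eventually_abs_sub_le _ hθ))
  refine exists_isObliqueReflection_of_approx (c := μ) (xn := fun n => N.scaledNetput μ n ω)
    (yn := fun n => idle μ (q n)) hP hN.spectralRadius_lt (isRCLL_fluidNetput hN μ)
    (fun k => tendstoUOC_scaledNetput (hA k)) (fun L ε hε => ?_) (fun n k => ?_)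
    (fun n k s t hs hst => ?_) (fun n k s t hs hst => ?_) fun L η hη => ?_
  · set θ := ε / (E + 2) with hθ
    have hθ0 : 0 < θ := by positivity
    obtain ⟨L', hL', hev⟩ := hgood L θ hθ0
    filter_upwards [hev] with n hn
    refine (hq n).isApproxRegulator hn.1 hP (fun k => hN.service_mono n k ω)
      (fun k => hN.service_zero n k ω) hμ hθ0 hL' hn.2.1 hn.2.2 fun k => ?_
    have h1 := mul_le_mul_of_nonneg_right (hEk k) hθ0.le
    have h2 : E * θ + 2 * θ = ε := by rw [← add_mul, hθ]; field_simp
    linarith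
  · simp [idle, IsRCLL.busyTime_zero]
  · exact mul_le_mul_of_nonneg_left (by linarith [((hq n).rcll k).busyTime_sub_le hs hst]) (hμ k).le
  · rw [idle, idle, ← mul_sub]
    exact mul_le_mul_of_nonneg_left (by linarith [((hq n).rcll k).busyTime_mono hs hst]) (hμ k).le
  · set θ := η / (E + 1) with hθ
    have hθ0 : 0 < θ := by positivity
    obtain ⟨L', hL', hev⟩ := hgood L θ hθ0
    filter_upwards [hev] with n hn k s t hs hst ht hr
    refine (hq n).idle_eq hn.1 hP hμ hL' hn.2.1 hn.2.2 hs hst ht fun r hrm => ?_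
    have h1 := mul_le_mul_of_nonneg_right (hEk k) hθ0.le
    have h2 : E * θ + θ = η := by rw [← add_one_mul, hθ]; field_simp
    linarith [hr r hrm]

end TransitoryNetwork

theorem isObliqueReflection_regulator {K : ℕ} {V : Matrix (Fin K) (Fin K) ℝ}
    {x : ℝ → Fin K → ℝ} (h : ∃ y, ∃ z, IsObliqueReflection V x z y) :
    ∃ z, IsObliqueReflection V x z (regulator V x) := by
  rw [regulator, dif_pos h]
  exact h.choose_spec

theorem mainTheorem6 {Ω : Type*} [MeasurableSpace Ω] (Pr : Measure Ω) [IsProbabilityMeasure Pr]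
    {K : ℕ} (N : TransitoryNetwork K Ω) (hN : N.IsModel Pr)
    -- the service rates of the `n`-th network, and the constant limiting service rates
    (rate : ℕ → Fin K → ℝ → ℝ) (μ : Fin K → ℝ)
    (hrate_nonneg : ∀ n k s, 0 ≤ s → 0 ≤ rate n k s)
    (hrate_int : ∀ n k t, 0 ≤ t → IntervalIntegrable (rate n k) volume 0 t)
    (hμ : ∀ k, 0 < μ k)
    (hrate_lim : ∀ k, TendstoUOC (fun n t => ∫ s in (0 : ℝ)..t, rate n k s)
      (fun t => ∫ _ in (0 : ℝ)..t, μ k))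
    -- functional strong law for the service processes
    (hservice : ∀ᵐ ω ∂Pr, ∀ k, TendstoUOC
      (fun n t => (N.service n k ω t : ℝ) / n - ∫ s in (0 : ℝ)..t, rate n k s) (fun _ => 0))
    -- functional strong law for the routing processes
    (hroute : ∀ᵐ ω ∂Pr, ∀ l k, TendstoUOC
      (fun n t => (N.routed l k ω ⌊(n : ℝ) * t⌋₊ : ℝ) / n) (fun t => N.P l k * t))
    -- the queue-length processes
    (Q : ℕ → Ω → Fin K → ℝ → ℤ) (hQ : ∀ n ω, N.IsQueuePath n ω (Q n ω)) :
    -- the oblique reflection problem for the fluid netput has exactly one solution on `[0, ∞)`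
    ((∃ z, IsObliqueReflection N.reflectionMatrix (N.fluidNetput Pr fun k _ => μ k) z
        (regulator N.reflectionMatrix (N.fluidNetput Pr fun k _ => μ k))) ∧
      ∀ z y, IsObliqueReflection N.reflectionMatrix (N.fluidNetput Pr fun k _ => μ k) z y →
        EqOn y (regulator N.reflectionMatrix (N.fluidNetput Pr fun k _ => μ k)) (Ici 0)) ∧
    -- the convergence of the busy-time processes
    ∀ᵐ ω ∂Pr, TendstoUOC (fun n t k => busyTime (Q n ω k) t)
      (fun t => t • (1 : Fin K → ℝ) - (Matrix.diagonal fun k => 1 / μ k).mulVec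
        (regulator N.reflectionMatrix (N.fluidNetput Pr fun k _ => μ k) t)) := by
  have hP := TransitoryNetwork.P_nonneg hN
  have hgood : ∀ᵐ ω ∂Pr,
      ∃ y, IsObliqueReflection N.reflectionMatrix (N.fluidNetput Pr fun k _ => μ k)
        (fun t => N.fluidNetput Pr (fun k _ => μ k) t + N.reflectionMatrix.mulVec (y t)) y ∧
      ∀ k, TendstoUOC (fun n t => TransitoryNetwork.idle μ (Q n ω) t k) fun t => y t k := by
    filter_upwards [hservice, hroute, ae_all_iff.2 fun k =>
      TransitoryNetwork.ae_tendstoUOC_arrivals hN k] with ω hS hR hA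
    refine TransitoryNetwork.exists_isObliqueReflection hN hμ (fun n => hQ n ω) hA
      (fun k => tendstoUOC_of_eventually fun L ε hε => ?_) hR
    filter_upwards [(hS k).eventually_abs_sub_le L (half_pos hε),
      (hrate_lim k).eventually_abs_sub_le L (half_pos hε)] with n h1 h2 t ht
    have h3 := abs_le.1 (h1 t ht)
    have h4 := abs_le.1 (h2 t ht)
    rw [intervalIntegral.integral_const, sub_zero, smul_eq_mul, mul_comm t] at h4
    rw [abs_le]
    constructor <;> linarith [h3.1, h3.2, h4.1, h4.2]
  obtain ⟨z, hz⟩ : ∃ z, IsObliqueReflection N.reflectionMatrix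
      (N.fluidNetput Pr fun k _ => μ k) z
      (regulator N.reflectionMatrix (N.fluidNetput Pr fun k _ => μ k)) := by
    -- The fluid netput is deterministic, so a single good sample point already solves the
    -- reflection problem.
    obtain ⟨ω, y, hy, -⟩ := hgood.exists
    exact isObliqueReflection_regulator ⟨y, _, hy⟩
  have huniq : ∀ z y, IsObliqueReflection N.reflectionMatrix
      (N.fluidNetput Pr fun k _ => μ k) z y →
      EqOn y (regulator N.reflectionMatrix (N.fluidNetput Pr fun k _ => μ k)) (Ici 0) :=
    fun z' y' h' => h'.eqOn hP hN.spectralRadius_lt hz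
  refine ⟨⟨⟨z, hz⟩, huniq⟩, ?_⟩
  -- The limit `y` obtained here depends on `ω`; uniqueness identifies it with the regulator on `[0,
  -- ∞)`.
  filter_upwards [hgood] with ω ⟨y, hy, hlim⟩ L
  refine Metric.tendstoUniformlyOn_iff.2 fun ε hε => ?_
  -- The tolerance carries the factor `μ k` because recovering the busy time from the idle time
  -- divides by `μ k`.
  have hev : ∀ᶠ n in atTop, ∀ k, ∀ t ∈ Icc 0 L,
      |TransitoryNetwork.idle μ (Q n ω) t k - y t k| ≤ μ k * (ε / 2) :=
    eventually_all.2 fun k => (hlim k).eventually_abs_sub_le L (mul_pos (hμ k) (half_pos hε))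
  filter_upwards [hev] with n hn t ht
  refine lt_of_le_of_lt ((dist_pi_le_iff (half_pos hε).le).2 fun k => ?_) (half_lt_self hε)
  have h1 := hn k t ht
  have h2 : y t k - TransitoryNetwork.idle μ (Q n ω) t k
      = μ k * (busyTime (Q n ω k) t - (t - 1 / μ k * y t k)) := by
    have := (hμ k).ne'
    rw [TransitoryNetwork.idle]
    field_simp
    ring
  rw [abs_sub_comm, h2, abs_mul, abs_of_pos (hμ k)] at h1
  have h3 := le_of_mul_le_mul_left h1 (hμ k)
  rw [dist_comm, Real.dist_eq, ← huniq _ y hy ht.1]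
  simpa [Matrix.mulVec_diagonal] using h3
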